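/- A weight function is a non-decreasing $\omega:[0,\infty)\to[0,\infty)$ with $\omega(t)\to\infty$ as $t\to\infty$. It is a BMT-weight function if it is continuous, $\omega(0)=0$, $\omega(2t)=O(\omega(t))$ and $\log t=o(\omega(t))$ as $t\to\infty$, and $t\mapsto\omega(e^t)$ is convex on $\mathbb R$. It is normalized if $\omega=0$ on $[0,1]$, non-quasianalytic if $\int_1^\infty \omega(t)t^{-2}\,dt<\infty$, and almost subadditive if for every $q>1$ there is $C_q\ge1$ with $\omega(s+t)\le q(\omega(s)+\omega(t))+C_q$ for all $s,t\ge0$. Weight functions $\sigma,\tau$ are equivalent if $\sigma=O(\tau)$ and $\tau=O(\sigma)$ at infinity. For $M\in\mathbb R_{>0}^{\mathbb N}$ with $M_0=1$ put $\mu_0=1$, $\mu_j=M_j/M_{j-1}$ for $j\ge1$, and $\omega_M(t)=\sup_{j\ge0}\log(|t|^j/M_j)$ for $t\neq0$, $\omega_M(0)=0$. Let $\mathcal{LC}$ be the set of all such $M$ with $M_1\ge1$, $M_j^2\le M_{j-1}M_{j+1}$ for all $j\ge1$ and $M_j^{1/j}\to\infty$. Sequences $M,N$ are equivalent if $0<\inf_{j\ge1}(M_j/N_j)^{1/j}\le\sup_{j\ge1}(M_j/N_j)^{1/j}<\infty$.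 The sequence $M$ has (nq) if $\sum_{j\ge1}1/\mu_j<\infty$; (mg) if for some $C\ge1$, $M_{j+k}\le C^{j+k+1}M_jM_k$ for all $j,k\ge0$; $(\beta_3)$ if $\liminf_j\mu_{Qj}/\mu_j>1$ for some integer $Q\ge2$. Its growth index $\gamma(M)$ is the supremum of all $\gamma\in\mathbb R$ for which there are $a\ge1$ and real $(\nu_j)_{j\ge1}$ with $a^{-1}\mu_j\le\nu_j\le a\mu_j$ for all $j\ge1$ and $(\nu_j/j^\gamma)_{j\ge1}$ non-decreasing. **Theorem.** (i) There is an uncountable set $\mathcal F\subset\mathcal{LC}$ such that for each $M\in\mathcal F$ the function $\omega_M$ is a (finite-valued) normalized, non-quasianalytic BMT-weight function and no weight function equivalent to $\omega_M$ is almost subadditive, and such that for distinct $M,N\in\mathcal F$ neither the sequences $M,N$ nor the functions $\omega_M,\omega_N$ are equivalent. (ii) Explicitly, let $A_0>2$. There exist strictly increasing sequences $(d_j)_{j\ge1}$ of positive integers with $(2/A_0)^{d_j}\le 2^{-(j/2+1)}$ for all $j\ge1$. For any such $(d_j)$ put $a_1=1$, $b_j=2^{d_j}a_j$, $a_{j+1}=2^jb_j$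 for $j\ge1$. For each $A\ge A_0$ there is exactly one sequence $M^A$ with $M^A_k=\prod_{i=0}^k\mu_i$, where $\mu_0=1$, $\mu_{a_1}=2$, and for all $j\ge1$: $\mu_k=A\,\mu_{2^ia_j}$ whenever $0\le i<d_j$ and $2^ia_j<k\le2^{i+1}a_j$; and $\mu_k=\sqrt2^{\,1/(2^ib_j)}\mu_{k-1}$ whenever $0\le i<j$ and $2^ib_j<k\le2^{i+1}b_j$. Each $M=M^A$ with $A\ge A_0$ lies in $\mathcal{LC}$, satisfies (nq), (mg), $(\beta_3)$ and $\gamma(M)<1$, its function $\omega_M$ is a (finite-valued) normalized, non-quasianalytic BMT-weight function, and no weight function equivalent to $\omega_M$ is almost subadditive. For distinct $A,A'\ge A_0$ neither $M^A,M^{A'}$ nor $\omega_{M^A},\omega_{M^{A'}}$ are equivalent. -/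

import Mathlib

open Set Filter Asymptotics MeasureTheory

noncomputable section

/-! ### Weight functions

Functions `[0,∞) → [0,∞)` are represented by functions `ℝ → ℝ`; only the values on `[0,∞)` are
ever used by the predicates below. -/

/-- Weight function: a non-decreasing function `[0,∞) → [0,∞)` tending to infinity. -/
structure IsWeightFunction (ω : ℝ → ℝ) : Prop where
  nonneg : ∀ t, 0 ≤ t → 0 ≤ ω t
  mono : MonotoneOn ω (Ici 0)
  tendsto : Tendsto ω atTop atTop

/-- Braun-Meise-Taylor weight function. -/
structure IsBMTWeight (ω : ℝ → ℝ) : Prop where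
  nonneg : ∀ t, 0 ≤ t → 0 ≤ ω t
  cont : ContinuousOn ω (Ici 0)
  mono : MonotoneOn ω (Ici 0)
  zero : ω 0 = 0
  /-- `ω (2t) = O (ω t)` -/
  om1 : (fun t => ω (2 * t)) =O[atTop] ω
  /-- `log t = o (ω t)` -/
  om3 : Real.log =o[atTop] ω
  /-- `t ↦ ω (exp t)` is convex on `ℝ` -/
  om4 : ConvexOn ℝ univ (fun t => ω (Real.exp t))

/-- `ω` vanishes on `[0,1]`. -/
def IsNormalizedWeight (ω : ℝ → ℝ) : Prop :=
  ∀ t, 0 ≤ t → t ≤ 1 → ω t = 0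

/-- `∫_1^∞ ω(t) / t^2 dt < ∞`. -/
def IsNonQuasianalyticWeight (ω : ℝ → ℝ) : Prop :=
  IntegrableOn (fun t => ω t / t ^ 2) (Ici 1) volume

/-- Equivalence of weights: `τ = O(σ)` and `σ = O(τ)` at infinity. -/
def WeightEquiv (σ τ : ℝ → ℝ) : Prop :=
  τ =O[atTop] σ ∧ σ =O[atTop] τ

/-- Almost subadditivity. -/
def AlmostSubadditive (ω : ℝ → ℝ) : Prop :=
  ∀ q : ℝ, 1 < q → ∃ C : ℝ, 1 ≤ C ∧
    ∀ s t : ℝ, 0 ≤ s → 0 ≤ t → ω (s + t) ≤ q * (ω s + ω t) + C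

/-! ### Weight sequences -/

/-- The quotients `μ_j = M_j / M_{j-1}`, `μ_0 = 1`. -/
def quotientSeq (M : ℕ → ℝ) : ℕ → ℝ
  | 0 => 1
  | j + 1 => M (j + 1) / M j

/-- The class `LC`: positive, normalized, log-convex sequences with `(M_j)^{1/j} → ∞`. -/
structure IsLC (M : ℕ → ℝ) : Prop where
  pos : ∀ j, 0 < M j
  zero : M 0 = 1
  one : 1 ≤ M 1
  logConvex : ∀ j, M (j + 1) ^ 2 ≤ M j * M (j + 2)
  root_tendsto : Tendsto (fun j : ℕ => M j ^ (1 / (j : ℝ))) atTop atTop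

/-- Moderate growth (mg). -/
def ModerateGrowth (M : ℕ → ℝ) : Prop :=
  ∃ C : ℝ, 1 ≤ C ∧ ∀ j k : ℕ, M (j + k) ≤ C ^ (j + k + 1) * M j * M k

/-- Non-quasianalyticity (nq): `∑_{j ≥ 1} 1 / μ_j < ∞`. -/
def NonQuasianalyticSeq (M : ℕ → ℝ) : Prop :=
  Summable (fun j : ℕ => 1 / quotientSeq M (j + 1))

/-- Condition (β₃): `liminf_j μ_{Qj} / μ_j > 1` for some integer `Q ≥ 2`. -/
def BetaThree (M : ℕ → ℝ) : Prop :=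
  ∃ Q : ℕ, 2 ≤ Q ∧
    1 < liminf (fun j : ℕ => ((quotientSeq M (Q * j) / quotientSeq M j : ℝ) : EReal)) atTop

/-- Thilliez' property `(P_γ)`: the quotients `(μ_j)_{j ≥ 1}` are comparable to a sequence
`(ν_j)_{j ≥ 1}` for which `ν_j / j^γ` is non-decreasing. -/
def ThilliezProperty (M : ℕ → ℝ) (γ : ℝ) : Prop :=
  ∃ ν : ℕ → ℝ,
    (∃ a : ℝ, 1 ≤ a ∧ ∀ j, 1 ≤ j →
      a⁻¹ * quotientSeq M j ≤ ν j ∧ ν j ≤ a * quotientSeq M j) ∧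
    MonotoneOn (fun j : ℕ => ν j / (j : ℝ) ^ γ) (Ici 1)

/-- Thilliez' growth index `γ(M)`, the supremum of all real `γ` with `(P_γ)`. -/
def growthIndexSeq (M : ℕ → ℝ) : EReal :=
  ⨆ γ ∈ {γ : ℝ | ThilliezProperty M γ}, (γ : EReal)

/-- Equivalence of (positive) sequences:
`0 < inf_{j ≥ 1} (M_j / N_j)^{1/j}` and `sup_{j ≥ 1} (M_j / N_j)^{1/j} < ∞`. -/
def SeqEquiv (M N : ℕ → ℝ) : Prop :=
  ∃ c C : ℝ, 0 < c ∧ ∀ j : ℕ, 1 ≤ j →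
    c ≤ (M j / N j) ^ (1 / (j : ℝ)) ∧ (M j / N j) ^ (1 / (j : ℝ)) ≤ C

/-- The associated function `ω_M(t) = sup_j log (|t|^j / M_j)` for `t ≠ 0`, `ω_M(0) = 0`. The
supremum is the true one where it is finite, see `AssocFinite`. -/
def assocFun (M : ℕ → ℝ) (t : ℝ) : ℝ :=
  if t = 0 then 0 else ⨆ j : ℕ, Real.log (|t| ^ j / M j)

/-- `ω_M` takes only finite values. -/
def AssocFinite (M : ℕ → ℝ) : Prop :=
  ∀ t : ℝ, t ≠ 0 → BddAbove (range fun j : ℕ => Real.log (|t| ^ j / M j))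

/-! ### The block construction

All block sequences are indexed by `j ≥ 1`; values at the index `0` are irrelevant. -/

/-- `a_1 = 1`, `a_{j+1} = 2^j b_j`, where `b_j = 2^{d_j} a_j`. -/
def blockA (d : ℕ → ℕ) : ℕ → ℕ
  | 0 => 1
  | 1 => 1
  | j + 2 => 2 ^ (j + 1) * (2 ^ d (j + 1) * blockA d (j + 1))

/-- `b_j = 2^{d_j} a_j`. -/
def blockB (d : ℕ → ℕ) (j : ℕ) : ℕ :=
  2 ^ d j * blockA d j

/-- `(d_j)_{j ≥ 1}` is a strictly increasing sequence of positive integers with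
`(2/A)^{d_j} ≤ 2^{-(j/2+1)}`. -/
structure IsAdmissible (A : ℝ) (d : ℕ → ℕ) : Prop where
  strictMono : StrictMonoOn d (Ici 1)
  one : 1 ≤ d 1
  growth : ∀ j : ℕ, 1 ≤ j → (2 / A) ^ d j ≤ 1 / (2 : ℝ) ^ ((j : ℝ) / 2 + 1)

/-- The quotient sequence of the block construction with parameter `A`: on each dyadic interval
`(2^i a_j, 2^{i+1} a_j]` inside `(a_j, b_j]` it is constant, equal to `A` times its value at the
left end point; from `b_j` to `a_{j+1}` it grows geometrically, by the factor `√2` over each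
dyadic interval. -/
structure IsBlockQuotient (A : ℝ) (d : ℕ → ℕ) (μ : ℕ → ℝ) : Prop where
  zero : μ 0 = 1
  one : μ (blockA d 1) = 2
  fast : ∀ j i k : ℕ, 1 ≤ j → i < d j →
    2 ^ i * blockA d j < k → k ≤ 2 ^ (i + 1) * blockA d j →
      μ k = A * μ (2 ^ i * blockA d j)
  slow : ∀ j i k : ℕ, 1 ≤ j → i < j →
    2 ^ i * blockB d j < k → k ≤ 2 ^ (i + 1) * blockB d j →
      μ k = (√2) ^ (1 / ((2 : ℝ) ^ i * (blockB d j : ℝ))) * μ (k - 1)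

/-- `M_k = ∏_{i ≤ k} μ_i` with `μ` given by the block construction. -/
def IsBlockSequence (A : ℝ) (d : ℕ → ℕ) (M : ℕ → ℝ) : Prop :=
  ∃ μ : ℕ → ℝ, IsBlockQuotient A d μ ∧ ∀ k, M k = ∏ i ∈ Finset.range (k + 1), μ i

end

/-! Everything is read off from the non-decreasing quotients `μ`, sampled at the powers of two: over
`(2 ^ n, 2 ^ (n + 1)]` they gain a factor `A > 2` (fast) or `√2` (slow). Since `log (t ^ j / M j)`
is a sum of `log (t / μ i)` with decreasing terms, the associated function is the sum of the
positive parts of these logarithms. Its regularity follows from simple bounds on `μ`: `2 μ_k ≤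
μ_{16k}` controls `ω (2t)`, while `μ_{2k} ≤ A² μ_k` gives moderate growth. By condensation, (nq)
amounts to summability of `2 ^ n / μ_{2^n}`; admissibility of `d` makes this term at least halve
from `a_j` to `a_{j+1}`.

The two negative statements rest on `ω (μ_k) = O(k)` (`assocFun_apply_le`) and `ω (r μ_k) ≥ k log r`
(`mul_log_le_assocFun`). Almost subadditivity of an equivalent weight would force `ω (2 ^ n t) ≤ D 3
^ n ω (t)`. Along a long slow stretch, however, `μ_{4^n k} ≤ 2 ^ n μ_k`, so enlarging `t` by about
`2 ^ n` enlarges `ω` by the order of `4 ^ n`. For `A < A'` the ratio of the quotients at `b_j` is at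
least `(A' / A) ^ d_j`, which is unbounded. Comparison at these indices separates both the sequences
and the functions, and the parameters `A ≥ 3` yield the uncountable family. -/

/-- The sequence of partial products of `μ`. -/
def prodSeq (μ : ℕ → ℝ) (k : ℕ) : ℝ := ∏ i ∈ Finset.range (k + 1), μ i

/-! ### Sequences with non-decreasing quotients and their associated functions -/

section General

variable {μ : ℕ → ℝ}

theorem prodSeq_succ (μ : ℕ → ℝ) (k : ℕ) : prodSeq μ (k + 1) = prodSeq μ k * μ (k + 1) := by
  unfold prodSeq
  rw [Finset.prod_range_succ]

theorem prodSeq_zero (h0 : μ 0 = 1) : prodSeq μ 0 = 1 := by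
  simp [prodSeq, h0]

theorem one_le_of_monotone (h0 : μ 0 = 1) (hm : Monotone μ) (k : ℕ) : 1 ≤ μ k :=
  h0 ▸ hm (Nat.zero_le k)

theorem pos_of_monotone (h0 : μ 0 = 1) (hm : Monotone μ) (k : ℕ) : 0 < μ k :=
  one_pos.trans_le (one_le_of_monotone h0 hm k)

theorem one_le_prodSeq (h0 : μ 0 = 1) (hm : Monotone μ) (k : ℕ) : 1 ≤ prodSeq μ k := by
  induction k with
  | zero => rw [prodSeq_zero h0]
  | succ k ih =>
    rw [prodSeq_succ]
    exact one_le_mul_of_one_le_of_one_le ih (one_le_of_monotone h0 hm _)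

theorem prodSeq_pos (h0 : μ 0 = 1) (hm : Monotone μ) (k : ℕ) : 0 < prodSeq μ k :=
  one_pos.trans_le (one_le_prodSeq h0 hm k)

theorem quotientSeq_prodSeq (h0 : μ 0 = 1) (hm : Monotone μ) : quotientSeq (prodSeq μ) = μ := by
  funext k
  cases k with
  | zero => simp [quotientSeq, h0]
  | succ k =>
    have := (prodSeq_pos h0 hm k).ne'
    rw [quotientSeq, prodSeq_succ]
    field_simp

theorem prodSeq_le_pow (h0 : μ 0 = 1) (hm : Monotone μ) (k : ℕ) : prodSeq μ k ≤ μ k ^ k := by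
  induction k with
  | zero => simp [prodSeq_zero h0]
  | succ k ih =>
    rw [prodSeq_succ, pow_succ]
    have := pos_of_monotone h0 hm (k + 1)
    gcongr
    exact ih.trans (pow_le_pow_left₀ (pos_of_monotone h0 hm k).le (hm k.le_succ) k)

/-- A tail of the product dominates the corresponding power. -/
theorem prodSeq_mul_pow_le (h0 : μ 0 = 1) (hm : Monotone μ) (k n : ℕ) :
    prodSeq μ k * μ k ^ n ≤ prodSeq μ (k + n) := by
  induction n with
  | zero => simp
  | succ n ih =>
    rw [← add_assoc, prodSeq_succ, pow_succ, ← mul_assoc]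
    have := pos_of_monotone h0 hm k
    have := prodSeq_pos h0 hm (k + n)
    exact mul_le_mul ih (hm (by omega)) (by positivity) (by positivity)

theorem log_pow_div_prodSeq (h0 : μ 0 = 1) (hm : Monotone μ) (t : ℝ) (ht : 0 < t) (j : ℕ) :
    Real.log (t ^ j / prodSeq μ j) = ∑ i ∈ Finset.range j, Real.log (t / μ (i + 1)) := by
  induction j with
  | zero => simp [prodSeq_zero h0]
  | succ j ih =>
    have h1 := pos_of_monotone h0 hm (j + 1)
    have h2 := prodSeq_pos h0 hm j
    rw [Finset.sum_range_succ, ← ih, ← Real.log_mul (by positivity) (by positivity), prodSeq_succ,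
      pow_succ]
    congr 1
    field_simp

theorem log_le_sum_posLog (h0 : μ 0 = 1) (hm : Monotone μ) {t : ℝ} (ht : 0 < t) {j n : ℕ}
    (hjn : j ≤ n) :
    Real.log (t ^ j / prodSeq μ j) ≤ ∑ i ∈ Finset.range n, Real.posLog (t / μ (i + 1)) := by
  rw [log_pow_div_prodSeq h0 hm t ht]
  calc _ ≤ ∑ i ∈ Finset.range j, Real.posLog (t / μ (i + 1)) :=
        Finset.sum_le_sum fun i _ => le_max_right _ _
    _ ≤ _ := Finset.sum_le_sum_of_subset_of_nonneg (by simpa using hjn)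
        fun i _ _ => Real.posLog_nonneg

/-- By monotonicity the indices with `μ i ≤ t` form an initial segment, so keeping only positive
parts is the same as stopping the sum of logarithms at one index. -/
theorem sum_posLog_eq_log (h0 : μ 0 = 1) (hm : Monotone μ) {t : ℝ} (ht : 0 < t) (n : ℕ) :
    ∃ k, ∑ i ∈ Finset.range n, Real.posLog (t / μ (i + 1)) = Real.log (t ^ k / prodSeq μ k) := by
  induction n with
  | zero => exact ⟨0, by simp [prodSeq_zero h0]⟩
  | succ n ih =>
    by_cases h : μ (n + 1) ≤ t
    · refine ⟨n + 1, ?_⟩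
      rw [log_pow_div_prodSeq h0 hm t ht]
      refine Finset.sum_congr rfl fun i hi => ?_
      refine Real.posLog_eq_log ?_
      rw [abs_of_pos (div_pos ht (pos_of_monotone h0 hm _)),
        one_le_div (pos_of_monotone h0 hm _)]
      exact (hm (by simp at hi; omega)).trans h
    · obtain ⟨k, hk⟩ := ih
      refine ⟨k, ?_⟩
      rw [Finset.sum_range_succ, hk, add_eq_left, Real.posLog_eq_zero_iff,
        abs_of_pos (div_pos ht (pos_of_monotone h0 hm _)), div_le_one (pos_of_monotone h0 hm _)]
      exact (not_le.1 h).le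

theorem sum_posLog_le (h0 : μ 0 = 1) (hm : Monotone μ) {t : ℝ} {k : ℕ} (ht : 0 < t)
    (hk : t ≤ μ k) (n : ℕ) :
    ∑ i ∈ Finset.range n, Real.posLog (t / μ (i + 1)) ≤
      ∑ i ∈ Finset.range k, Real.posLog (t / μ (i + 1)) := by
  rcases le_total n k with h | h
  · exact Finset.sum_le_sum_of_subset_of_nonneg (by simpa using h)
      fun i _ _ => Real.posLog_nonneg
  · refine (Finset.sum_subset (by simpa using h) fun i _ hi => ?_).ge
    rw [Real.posLog_eq_zero_iff,
        abs_of_pos (div_pos ht (pos_of_monotone h0 hm _)), div_le_one (pos_of_monotone h0 hm _)]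
    exact hk.trans (hm (by simp at hi; omega))

theorem assocFinite_prodSeq (h0 : μ 0 = 1) (hm : Monotone μ) (hμ : Tendsto μ atTop atTop) :
    AssocFinite (prodSeq μ) := by
  intro t ht
  obtain ⟨k, hk⟩ := (hμ.eventually_ge_atTop |t|).exists
  refine ⟨∑ i ∈ Finset.range k, Real.posLog (|t| / μ (i + 1)), ?_⟩
  rintro _ ⟨j, rfl⟩
  exact (log_le_sum_posLog h0 hm (abs_pos.2 ht) le_rfl).trans
    (sum_posLog_le h0 hm (abs_pos.2 ht) hk j)

theorem log_le_assocFun (h0 : μ 0 = 1) (hm : Monotone μ) (hμ : Tendsto μ atTop atTop)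
    {t : ℝ} (ht : 0 < t) (j : ℕ) :
    Real.log (t ^ j / prodSeq μ j) ≤ assocFun (prodSeq μ) t := by
  rw [assocFun, if_neg ht.ne']
  have := le_ciSup (assocFinite_prodSeq h0 hm hμ t ht.ne') j
  simpa only [abs_of_pos ht] using this

theorem assocFun_le {M : ℕ → ℝ} {t : ℝ} (ht : 0 < t) {c : ℝ}
    (h : ∀ j, Real.log (t ^ j / M j) ≤ c) : assocFun M t ≤ c := by
  rw [assocFun, if_neg ht.ne']
  refine ciSup_le fun j => ?_
  rw [abs_of_pos ht]
  exact h j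

theorem sum_posLog_le_assocFun (h0 : μ 0 = 1) (hm : Monotone μ) (hμ : Tendsto μ atTop atTop)
    {t : ℝ} (ht : 0 < t) (n : ℕ) :
    ∑ i ∈ Finset.range n, Real.posLog (t / μ (i + 1)) ≤ assocFun (prodSeq μ) t := by
  obtain ⟨k, hk⟩ := sum_posLog_eq_log h0 hm ht n
  rw [hk]
  exact log_le_assocFun h0 hm hμ ht k

theorem assocFun_nonneg (h0 : μ 0 = 1) (hm : Monotone μ) (hμ : Tendsto μ atTop atTop)
    {t : ℝ} (ht : 0 ≤ t) : 0 ≤ assocFun (prodSeq μ) t := by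
  rcases ht.eq_or_lt with rfl | ht
  · simp [assocFun]
  · simpa using sum_posLog_le_assocFun h0 hm hμ ht 0

theorem assocFun_le_sum (h0 : μ 0 = 1) (hm : Monotone μ) {t : ℝ} {k : ℕ} (ht : 0 < t)
    (hk : t ≤ μ k) :
    assocFun (prodSeq μ) t ≤ ∑ i ∈ Finset.range k, Real.posLog (t / μ (i + 1)) :=
  assocFun_le ht fun j => (log_le_sum_posLog h0 hm ht le_rfl).trans (sum_posLog_le h0 hm ht hk j)

theorem assocFun_monotoneOn (h0 : μ 0 = 1) (hm : Monotone μ) (hμ : Tendsto μ atTop atTop) :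
    MonotoneOn (assocFun (prodSeq μ)) (Ici 0) := by
  intro s hs t _ hst
  rcases (mem_Ici.1 hs).eq_or_lt with rfl | hs
  · rw [assocFun, if_pos rfl]
    exact assocFun_nonneg h0 hm hμ hst
  · refine assocFun_le hs fun j => le_trans ?_ (log_le_assocFun h0 hm hμ (hs.trans_le hst) j)
    have := prodSeq_pos h0 hm j
    gcongr

theorem assocFun_normalized (h0 : μ 0 = 1) (hm : Monotone μ) (hμ : Tendsto μ atTop atTop) :
    IsNormalizedWeight (assocFun (prodSeq μ)) := by
  intro t ht ht1
  refine le_antisymm ?_ (assocFun_nonneg h0 hm hμ ht)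
  rcases ht.eq_or_lt with rfl | ht
  · simp [assocFun]
  · simpa using assocFun_le_sum (k := 0) h0 hm ht (h0 ▸ ht1)

theorem assocFun_convexOn (h0 : μ 0 = 1) (hm : Monotone μ) (hμ : Tendsto μ atTop atTop) :
    ConvexOn ℝ univ (fun t => assocFun (prodSeq μ) (Real.exp t)) := by
  have key : ∀ (j : ℕ) (x : ℝ), Real.log (Real.exp x ^ j / prodSeq μ j) =
      j * x - Real.log (prodSeq μ j) := fun j x => by
    rw [Real.log_div (by positivity) (prodSeq_pos h0 hm j).ne', Real.log_pow, Real.log_exp]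
  refine ⟨convex_univ, fun x _ y _ a b ha hb hab => ?_⟩
  refine assocFun_le (Real.exp_pos _) fun j => ?_
  have h1 := log_le_assocFun h0 hm hμ (Real.exp_pos x) j
  have h2 := log_le_assocFun h0 hm hμ (Real.exp_pos y) j
  rw [key] at h1 h2 ⊢
  simp only [smul_eq_mul]
  have e : j * (a * x + b * y) - Real.log (prodSeq μ j) =
      a * (j * x - Real.log (prodSeq μ j)) + b * (j * y - Real.log (prodSeq μ j)) := by
    linear_combination Real.log (prodSeq μ j) * hab
  rw [e]
  gcongr

/-- Away from `0` this comes from convexity in the variable `log t`; near `0` the function vanishes.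
-/
theorem assocFun_continuousOn (h0 : μ 0 = 1) (hm : Monotone μ) (hμ : Tendsto μ atTop atTop) :
    ContinuousOn (assocFun (prodSeq μ)) (Ici 0) := by
  have hc : Continuous (fun t => assocFun (prodSeq μ) (Real.exp t)) := by
    rw [← continuousOn_univ]
    exact (assocFun_convexOn h0 hm hμ).continuousOn isOpen_univ
  intro t ht
  rcases (mem_Ici.1 ht).eq_or_lt with rfl | ht
  · refine (continuousWithinAt_const (b := (0 : ℝ))).congr_of_eventuallyEq ?_ (by simp [assocFun])
    filter_upwards [self_mem_nhdsWithin, mem_nhdsWithin_of_mem_nhds (Iio_mem_nhds one_pos)]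
      with x hx hx1
    exact assocFun_normalized h0 hm hμ x hx hx1.le
  · refine ContinuousAt.continuousWithinAt ?_
    have : ContinuousAt (fun s => assocFun (prodSeq μ) (Real.exp (Real.log s))) t :=
      hc.continuousAt.comp (Real.continuousAt_log ht.ne')
    refine this.congr ?_
    filter_upwards [Ioi_mem_nhds ht] with x hx
    rw [Real.exp_log hx]

theorem log_isLittleO_assocFun (h0 : μ 0 = 1) (hm : Monotone μ) (hμ : Tendsto μ atTop atTop) :
    Real.log =o[atTop] assocFun (prodSeq μ) := by
  rw [isLittleO_iff]
  intro c hc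
  -- The `j`-th term gives `c ω(t) ≥ 2 log t - c log M_j`; one of the two copies of `log t` absorbs
  -- the constant.
  obtain ⟨j, hj⟩ := exists_nat_gt (2 / c)
  have hjc : 2 < c * j := by rwa [div_lt_iff₀' hc] at hj
  filter_upwards [Real.tendsto_log_atTop.eventually_ge_atTop (c * Real.log (prodSeq μ j)),
    eventually_ge_atTop 1] with t h1 h2
  have ht : 0 < t := by linarith
  have h3 := log_le_assocFun h0 hm hμ ht j
  rw [Real.log_div (by positivity) (prodSeq_pos h0 hm j).ne', Real.log_pow] at h3
  have hl := Real.log_nonneg h2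
  rw [Real.norm_of_nonneg hl, Real.norm_of_nonneg (assocFun_nonneg h0 hm hμ ht.le)]
  nlinarith [mul_le_mul_of_nonneg_left h3 hc.le]

/-- Group the indices into runs of length `Q`. Each term of a later run, taken at `2t`, is bounded
by the single term at `t` indexed by the number of preceding runs. The first run costs `Q log (2t)`,
absorbed by `log t = o(ω t)`. -/
theorem assocFun_two_mul_isBigO (h0 : μ 0 = 1) (hm : Monotone μ) (hμ : Tendsto μ atTop atTop)
    {Q : ℕ} (hQ : ∀ k, 1 ≤ k → 2 * μ k ≤ μ (Q * k)) :
    (fun t => assocFun (prodSeq μ) (2 * t)) =O[atTop] assocFun (prodSeq μ) := by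
  have hQ0 : 0 < Q := by
    rcases Nat.eq_zero_or_pos Q with rfl | h
    · have := hQ 1 le_rfl
      have h1 := one_le_of_monotone h0 hm 1
      rw [Nat.zero_mul, h0] at this
      linarith
    · exact h
  have key : ∀ t : ℝ, 1 ≤ t → ∀ n, ∑ i ∈ Finset.range (Q * (n + 1)),
      Real.posLog (2 * t / μ (i + 1)) ≤ Q * Real.posLog (2 * t) +
        Q * ∑ i ∈ Finset.range n, Real.posLog (t / μ (i + 1)) := by
    intro t ht n
    induction n with
    | zero =>
      simp only [zero_add, mul_one, Finset.range_zero, Finset.sum_empty, mul_zero, add_zero]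
      refine (Finset.sum_le_card_nsmul _ _ (Real.posLog (2 * t)) fun i _ => ?_).trans (by simp)
      have := one_le_of_monotone h0 hm (i + 1)
      exact Real.posLog_le_posLog (by positivity) (div_le_self (by positivity) this)
    | succ n ih =>
      rw [mul_add_one Q (n + 1), Finset.sum_range_add, Finset.sum_range_succ _ n, mul_add (Q : ℝ),
        ← add_assoc]
      refine add_le_add ih ?_
      refine (Finset.sum_le_card_nsmul _ _ (Real.posLog (t / μ (n + 1))) fun i _ => ?_).trans
        (by simp)
      have h1 := pos_of_monotone h0 hm (n + 1)
      have h2 := pos_of_monotone h0 hm (Q * (n + 1) + i + 1)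
      refine Real.posLog_le_posLog (by positivity) ?_
      rw [div_le_div_iff₀ h2 h1]
      have h3 : 2 * μ (n + 1) ≤ μ (Q * (n + 1) + i + 1) :=
        (hQ _ (by omega)).trans (hm (by omega))
      nlinarith
  have hlog : ∀ᶠ t in atTop, Real.log t ≤ assocFun (prodSeq μ) t := by
    filter_upwards [(log_isLittleO_assocFun h0 hm hμ).def one_pos, eventually_ge_atTop 1]
      with t h1 h2
    rwa [one_mul, Real.norm_of_nonneg (Real.log_nonneg h2),
      Real.norm_of_nonneg (assocFun_nonneg h0 hm hμ (by linarith))] at h1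
  -- `2 Q` pays for the first run and `Q` for all the others.
  refine IsBigO.of_bound (3 * Q) ?_
  filter_upwards [hlog, eventually_ge_atTop 2] with t h1 h2
  have ht : 0 < t := by linarith
  rw [Real.norm_of_nonneg (assocFun_nonneg h0 hm hμ ht.le),
    Real.norm_of_nonneg (assocFun_nonneg h0 hm hμ (by positivity))]
  refine assocFun_le (by positivity) fun j => ?_
  refine (log_le_sum_posLog h0 hm (n := Q * (j + 1)) (by positivity) (by nlinarith)).trans ?_
  refine (key t (by linarith) j).trans ?_
  have h3 : Real.posLog (2 * t) ≤ 2 * assocFun (prodSeq μ) t := by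
    rw [Real.posLog_eq_log (by rw [abs_of_pos] <;> linarith), Real.log_mul two_ne_zero ht.ne']
    have := Real.log_le_log two_pos h2
    linarith
  have h4 := sum_posLog_le_assocFun h0 hm hμ ht j
  have h5 : (0 : ℝ) ≤ Q := Nat.cast_nonneg _
  nlinarith [mul_le_mul_of_nonneg_left h3 h5, mul_le_mul_of_nonneg_left h4 h5]

theorem isBMTWeight_assocFun (h0 : μ 0 = 1) (hm : Monotone μ) (hμ : Tendsto μ atTop atTop)
    {Q : ℕ} (hQ : ∀ k, 1 ≤ k → 2 * μ k ≤ μ (Q * k)) :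
    IsBMTWeight (assocFun (prodSeq μ)) where
  nonneg _ ht := assocFun_nonneg h0 hm hμ ht
  cont := assocFun_continuousOn h0 hm hμ
  mono := assocFun_monotoneOn h0 hm hμ
  zero := by simp [assocFun]
  om1 := assocFun_two_mul_isBigO h0 hm hμ hQ
  om3 := log_isLittleO_assocFun h0 hm hμ
  om4 := assocFun_convexOn h0 hm hμ

theorem isLC_prodSeq (h0 : μ 0 = 1) (hm : Monotone μ) (hμ : Tendsto μ atTop atTop) :
    IsLC (prodSeq μ) where
  pos := prodSeq_pos h0 hm
  zero := prodSeq_zero h0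
  one := one_le_prodSeq h0 hm 1
  logConvex j := by
    rw [prodSeq_succ μ (j + 1), prodSeq_succ μ j]
    have h1 := prodSeq_pos h0 hm j
    have h2 := pos_of_monotone h0 hm (j + 1)
    have h3 : μ (j + 1) ≤ μ (j + 2) := hm (by omega)
    calc _ = prodSeq μ j * (prodSeq μ j * μ (j + 1) * μ (j + 1)) := by ring
      _ ≤ _ := by gcongr
  root_tendsto := by
    rw [tendsto_atTop]
    intro R
    set c := max R 1 with hc
    have hc1 : 1 ≤ c := le_max_right _ _
    -- For `n ≥ 2k` at least half of the factors of `M_n` are at least `c ^ 2`, which makes up for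
    -- the first `k`.
    obtain ⟨k, hk⟩ := (hμ.eventually_ge_atTop (c ^ 2)).exists
    filter_upwards [eventually_ge_atTop (2 * k), eventually_ge_atTop 1] with n hn hn1
    have h1 : c ^ n ≤ prodSeq μ n := by
      obtain ⟨m, rfl⟩ : ∃ m, n = k + m := ⟨n - k, by omega⟩
      calc c ^ (k + m) ≤ c ^ (2 * m) := pow_le_pow_right₀ hc1 (by omega)
        _ = (c ^ 2) ^ m := pow_mul _ _ _
        _ ≤ 1 * μ k ^ m := by rw [one_mul]; gcongr
        _ ≤ prodSeq μ k * μ k ^ m := by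
          have := pos_of_monotone h0 hm k
          gcongr
          exact one_le_prodSeq h0 hm k
        _ ≤ _ := prodSeq_mul_pow_le h0 hm k m
    calc R ≤ c := le_max_left _ _
      _ = (c ^ n) ^ (1 / (n : ℝ)) := by
        rw [one_div, Real.pow_rpow_inv_natCast (by positivity) (by omega)]
      _ ≤ _ := Real.rpow_le_rpow (by positivity) h1 (by positivity)

variable {ν : ℕ → ℝ} {C : ℝ}

/-! ### Non-quasianalyticity -/

theorem integrableOn_posLog_div_sq {m : ℝ} (hm : 1 ≤ m) :
    IntegrableOn (fun t => Real.posLog (t / m) / t ^ 2) (Ioi 1) ∧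
      ∫ t in Ioi 1, Real.posLog (t / m) / t ^ 2 = 1 / m := by
  have hm0 : 0 < m := by linarith
  have heq : EqOn (fun t => Real.posLog (t / m) / t ^ 2)
      ((Ioi m).indicator fun t => Real.log (t / m) / t ^ 2) (Ioi 1) := by
    intro t ht
    have ht0 : 0 < t := one_pos.trans ht
    by_cases h : m < t
    · rw [indicator_of_mem (mem_Ioi.2 h)]
      dsimp only
      rw [Real.posLog_eq_log]
      rw [abs_of_pos (by positivity), one_le_div hm0]
      exact h.le
    · rw [indicator_of_notMem (by simpa using h)]
      dsimp only
      rw [(Real.posLog_eq_zero_iff _).2, zero_div]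
      rw [abs_of_pos (by positivity), div_le_one hm0]
      exact not_lt.1 h
  have hder : ∀ x ∈ Ici m, HasDerivAt (fun t => -((Real.log (t / m) + 1) / t))
      (Real.log (x / m) / x ^ 2) x := by
    intro x hx
    have hx0 : 0 < x := hm0.trans_le hx
    have h1 : HasDerivAt (fun t => Real.log (t / m)) (1 / m / (x / m)) x :=
      ((hasDerivAt_id x).div_const m).log (by positivity)
    refine ((h1.add_const 1).div (hasDerivAt_id x) hx0.ne').neg.congr_deriv ?_
    simp only [id]
    field_simp
    ring
  have hpos : ∀ x ∈ Ioi m, 0 ≤ Real.log (x / m) / x ^ 2 := by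
    intro x hx
    have := Real.log_nonneg ((one_le_div hm0).2 (mem_Ioi.1 hx).le)
    positivity
  have hlim : Tendsto (fun t => -((Real.log (t / m) + 1) / t)) atTop (nhds 0) := by
    have h1 : Tendsto (fun t : ℝ => Real.log t / t) atTop (nhds 0) :=
      Real.isLittleO_log_id_atTop.tendsto_div_nhds_zero
    have h2 : Tendsto (fun t : ℝ => (1 - Real.log m) / t) atTop (nhds 0) :=
      tendsto_const_nhds.div_atTop tendsto_id
    have h3 := (h1.add h2).neg
    simp only [add_zero, neg_zero] at h3
    refine h3.congr' ?_
    filter_upwards [eventually_gt_atTop 0] with t ht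
    rw [Real.log_div ht.ne' hm0.ne']
    ring
  constructor
  · refine IntegrableOn.congr_fun ?_ heq.symm measurableSet_Ioi
    exact ((integrable_indicator_iff measurableSet_Ioi).2
      (integrableOn_Ioi_deriv_of_nonneg' hder hpos hlim)).integrableOn
  · rw [setIntegral_congr_fun measurableSet_Ioi heq, setIntegral_indicator measurableSet_Ioi,
      Ioi_inter_Ioi, max_eq_right hm, integral_Ioi_of_hasDerivAt_of_nonneg' hder hpos hlim]
    simp [hm0.ne']

/-- On `[1, T]` only finitely many positive parts matter, and each contributes at most its full
integral `1 / μ i`; the sum of the reciprocals bounds the integral uniformly in `T`. -/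
theorem assocFun_nonQuasianalytic (h0 : μ 0 = 1) (hm : Monotone μ)
    (hμ : Tendsto μ atTop atTop) (hs : Summable fun j => 1 / μ (j + 1)) :
    IsNonQuasianalyticWeight (assocFun (prodSeq μ)) := by
  rw [IsNonQuasianalyticWeight, integrableOn_Ici_iff_integrableOn_Ioi]
  have hcont : ContinuousOn (fun t => assocFun (prodSeq μ) t / t ^ 2) (Ici 1) := by
    refine ((assocFun_continuousOn h0 hm hμ).mono (Ici_subset_Ici.2 zero_le_one)).div
      (by fun_prop) fun t ht => ?_
    have : (0 : ℝ) < t := one_pos.trans_le ht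
    positivity
  have hint : ∀ T : ℝ, IntegrableOn (fun t => assocFun (prodSeq μ) t / t ^ 2) (Ioc 1 T) :=
    fun T => ((hcont.mono Icc_subset_Ici_self).integrableOn_Icc).mono_set Ioc_subset_Icc_self
  refine integrableOn_Ioi_of_intervalIntegral_norm_bounded (∑' j, 1 / μ (j + 1)) 1 hint
    tendsto_id ?_
  filter_upwards [eventually_ge_atTop 1] with T hT
  obtain ⟨k, hk⟩ := (hμ.eventually_ge_atTop T).exists
  rw [intervalIntegral.integral_of_le hT]
  have hi : ∀ i ∈ Finset.range k,
      IntegrableOn (fun t => Real.posLog (t / μ (i + 1)) / t ^ 2) (Ioi 1) :=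
    fun i _ => (integrableOn_posLog_div_sq (one_le_of_monotone h0 hm _)).1
  calc ∫ t in Ioc 1 T, ‖assocFun (prodSeq μ) t / t ^ 2‖
      ≤ ∫ t in Ioc 1 T, ∑ i ∈ Finset.range k, Real.posLog (t / μ (i + 1)) / t ^ 2 := by
        refine setIntegral_mono_on (hint T).norm
          ((integrable_finsetSum _ hi).mono_measure
            (Measure.restrict_mono Ioc_subset_Ioi_self le_rfl)) measurableSet_Ioc fun t ht => ?_
        have ht0 : 0 < t := one_pos.trans ht.1
        have h1 := assocFun_nonneg h0 hm hμ ht0.le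
        rw [Real.norm_of_nonneg (by positivity), ← Finset.sum_div]
        gcongr
        exact assocFun_le_sum h0 hm ht0 (ht.2.trans hk)
    _ ≤ ∫ t in Ioi 1, ∑ i ∈ Finset.range k, Real.posLog (t / μ (i + 1)) / t ^ 2 := by
        refine setIntegral_mono_set (integrable_finsetSum _ hi) ?_
          Ioc_subset_Ioi_self.eventuallyLE
        filter_upwards with t
        exact Finset.sum_nonneg fun i _ => div_nonneg Real.posLog_nonneg (sq_nonneg t)
    _ = ∑ i ∈ Finset.range k, 1 / μ (i + 1) := by
        rw [integral_finsetSum _ hi]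
        exact Finset.sum_congr rfl fun i _ =>
          (integrableOn_posLog_div_sq (one_le_of_monotone h0 hm _)).2
    _ ≤ _ := hs.sum_le_tsum _ fun i _ => (one_div_pos.2 (pos_of_monotone h0 hm _)).le

/-! ### Moderate growth and the size of the associated function at the quotients -/

theorem prodSeq_two_mul_le (h0 : μ 0 = 1) (hm : Monotone μ) (hC : ∀ k, μ (2 * k) ≤ C * μ k)
    (k : ℕ) : prodSeq μ (2 * k) ≤ C ^ (2 * k) * prodSeq μ k ^ 2 := by
  induction k with
  | zero => simp [prodSeq_zero h0]
  | succ k ih =>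
    have h1 := pos_of_monotone h0 hm (2 * k + 1)
    have h2 := prodSeq_pos h0 hm (2 * k)
    have h3 : μ (2 * k + 1) ≤ μ (2 * (k + 1)) := hm (by omega)
    calc prodSeq μ (2 * (k + 1)) = prodSeq μ (2 * k) * μ (2 * k + 1) * μ (2 * (k + 1)) := by
          rw [show 2 * (k + 1) = 2 * k + 1 + 1 by ring, prodSeq_succ, prodSeq_succ]
      _ ≤ prodSeq μ (2 * k) * μ (2 * (k + 1)) * μ (2 * (k + 1)) := by
          have := pos_of_monotone h0 hm (2 * (k + 1))
          gcongr
      _ = prodSeq μ (2 * k) * μ (2 * (k + 1)) ^ 2 := by ring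
      _ ≤ C ^ (2 * k) * prodSeq μ k ^ 2 * (C * μ (k + 1)) ^ 2 := by
          have := pos_of_monotone h0 hm (2 * (k + 1))
          exact mul_le_mul ih (pow_le_pow_left₀ this.le (hC _) 2) (by positivity)
            (h2.le.trans ih)
      _ = _ := by rw [prodSeq_succ]; ring

/-- Log-convexity for a fixed index sum: the balanced product is the smallest. This reduces moderate
growth to equal or adjacent indices. -/
theorem prodSeq_mul_le_prodSeq_mul (h0 : μ 0 = 1) (hm : Monotone μ) {j k : ℕ} (hjk : j ≤ k)
    (i : ℕ) : prodSeq μ (j + i) * prodSeq μ k ≤ prodSeq μ j * prodSeq μ (k + i) := by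
  induction i with
  | zero => simp
  | succ i ih =>
    rw [← add_assoc, ← add_assoc, prodSeq_succ, prodSeq_succ]
    have h1 := pos_of_monotone h0 hm (j + i + 1)
    have h2 := prodSeq_pos h0 hm
    calc _ = prodSeq μ (j + i) * prodSeq μ k * μ (j + i + 1) := by ring
      _ ≤ prodSeq μ j * prodSeq μ (k + i) * μ (k + i + 1) :=
        mul_le_mul ih (hm (by omega)) h1.le (mul_pos (h2 _) (h2 _)).le
      _ = _ := by ring

theorem moderateGrowth_prodSeq (h0 : μ 0 = 1) (hm : Monotone μ) (hC1 : 1 ≤ C)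
    (hC : ∀ k, μ (2 * k) ≤ C * μ k) : ModerateGrowth (prodSeq μ) := by
  have hp := prodSeq_pos h0 hm
  have key : ∀ j k, j ≤ k → prodSeq μ (j + k) ≤ C ^ (j + k) * (prodSeq μ j * prodSeq μ k) := by
    intro j k hjk
    rcases Nat.even_or_odd' (j + k) with ⟨m, h | h⟩
    · obtain ⟨i, rfl⟩ : ∃ i, m = j + i := ⟨m - j, by omega⟩
      obtain rfl : k = j + i + i := by omega
      rw [h]
      refine (prodSeq_two_mul_le h0 hm hC _).trans ?_
      rw [sq]
      exact mul_le_mul_of_nonneg_left (prodSeq_mul_le_prodSeq_mul h0 hm (by omega) i)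
        (by positivity)
    · obtain ⟨i, rfl⟩ : ∃ i, m = j + i := ⟨m - j, by omega⟩
      obtain rfl : k = j + i + 1 + i := by omega
      rw [h]
      have h1 : μ (2 * (j + i) + 1) ≤ C * μ (j + i + 1) := (hm (by omega)).trans (hC _)
      calc prodSeq μ (2 * (j + i) + 1)
          ≤ C ^ (2 * (j + i)) * prodSeq μ (j + i) ^ 2 * (C * μ (j + i + 1)) := by
            rw [prodSeq_succ]
            exact mul_le_mul (prodSeq_two_mul_le h0 hm hC _) h1 (pos_of_monotone h0 hm _).le
              (by positivity)
        _ = C ^ (2 * (j + i) + 1) * (prodSeq μ (j + i) * prodSeq μ (j + i + 1)) := by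
            rw [prodSeq_succ]; ring
        _ ≤ _ := mul_le_mul_of_nonneg_left (prodSeq_mul_le_prodSeq_mul h0 hm (by omega) i)
            (by positivity)
  refine ⟨C, hC1, fun j k => ?_⟩
  have h2 : prodSeq μ (j + k) ≤ C ^ (j + k) * (prodSeq μ j * prodSeq μ k) := by
    rcases le_total j k with h | h
    · exact key j k h
    · rw [add_comm j k, mul_comm (prodSeq μ j)]
      exact key k j h
  refine h2.trans ?_
  rw [mul_assoc]
  have := mul_pos (hp j) (hp k)
  exact mul_le_mul_of_nonneg_right (pow_le_pow_right₀ hC1 (Nat.le_succ _)) this.le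

/-- A converse of `prodSeq_le_pow` up to a geometric factor, from `M_k μ_k ^ k ≤ M_{2k} ≤ C ^ (2k)
M_k ^ 2`. -/
theorem pow_le_prodSeq (h0 : μ 0 = 1) (hm : Monotone μ) (hC : ∀ k, μ (2 * k) ≤ C * μ k) (k : ℕ) :
    μ k ^ k ≤ C ^ (2 * k) * prodSeq μ k := by
  have h := (prodSeq_mul_pow_le h0 hm k k).trans (two_mul k ▸ prodSeq_two_mul_le h0 hm hC k)
  refine le_of_mul_le_mul_left (h.trans_eq ?_) (prodSeq_pos h0 hm k)
  ring

theorem assocFun_apply_le (h0 : μ 0 = 1) (hm : Monotone μ) (hC : ∀ k, μ (2 * k) ≤ C * μ k)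
    (k : ℕ) : assocFun (prodSeq μ) (μ k) ≤ k * (2 * Real.log C) := by
  have hp := pos_of_monotone h0 hm
  refine (assocFun_le_sum h0 hm (hp k) le_rfl).trans ?_
  have : ∑ i ∈ Finset.range k, Real.posLog (μ k / μ (i + 1)) =
      Real.log (μ k ^ k / prodSeq μ k) := by
    rw [log_pow_div_prodSeq h0 hm _ (hp k)]
    refine Finset.sum_congr rfl fun i hi => Real.posLog_eq_log ?_
    rw [abs_of_pos (div_pos (hp k) (hp _)), one_le_div (hp _)]
    exact hm (by simp at hi; omega)
  rw [this]
  have h1 := prodSeq_pos h0 hm k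
  have h2 := hp k
  calc _ ≤ Real.log (C ^ (2 * k)) := by
        refine Real.log_le_log (by positivity) ?_
        rw [div_le_iff₀ h1]
        exact pow_le_prodSeq h0 hm hC k
    _ = _ := by rw [Real.log_pow]; push_cast; ring

theorem mul_log_le_assocFun (h0 : μ 0 = 1) (hm : Monotone μ) (hμ : Tendsto μ atTop atTop)
    {t r : ℝ} (hr : 0 < r) (k : ℕ) (h : r * μ k ≤ t) :
    k * Real.log r ≤ assocFun (prodSeq μ) t := by
  have hk := pos_of_monotone h0 hm k
  have hk' := prodSeq_pos h0 hm k
  refine le_trans ?_ (log_le_assocFun h0 hm hμ ((by positivity : 0 < r * μ k).trans_le h) k)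
  rw [← Real.log_pow]
  refine Real.log_le_log (by positivity) ?_
  rw [le_div_iff₀ hk']
  calc r ^ k * prodSeq μ k ≤ r ^ k * μ k ^ k := by gcongr; exact prodSeq_le_pow h0 hm k
    _ = (r * μ k) ^ k := by ring
    _ ≤ _ := by gcongr

/-! ### Inequivalence from an unbounded ratio of quotients -/

/-- Test at `t = ν k`: there the function of `ν` is `O(k)`, while that of `μ` is at least `k log R`.
-/
theorem not_isBigO_assocFun (h0 : μ 0 = 1) (hm : Monotone μ) (hμ : Tendsto μ atTop atTop)
    (h0' : ν 0 = 1) (hm' : Monotone ν) (hν : Tendsto ν atTop atTop)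
    (hC : ∀ k, ν (2 * k) ≤ C * ν k) (hR : ∀ R : ℝ, ∃ k, 1 ≤ k ∧ R * μ k ≤ ν k) :
    ¬ assocFun (prodSeq μ) =O[atTop] assocFun (prodSeq ν) := by
  intro h
  obtain ⟨K, hK⟩ := h.bound
  obtain ⟨t₀, ht₀⟩ := eventually_atTop.1 hK
  -- The bound `t₀` places `ν k` in the range of the estimate, as `μ k ≥ 1`; the exponential makes
  -- `log R` beat the constant.
  obtain ⟨k, hk, hkR⟩ := hR (max (max t₀ 1) (Real.exp (|K| * (2 * Real.log C) + 1)))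
  set R := max (max t₀ 1) (Real.exp (|K| * (2 * Real.log C) + 1)) with hRdef
  have hR0 : 0 < R := (Real.exp_pos _).trans_le (le_max_right _ _)
  have hνk : R ≤ ν k := by
    have := one_le_of_monotone h0 hm k
    nlinarith
  have h1 := ht₀ (ν k) (((le_max_left _ _).trans (le_max_left _ _)).trans hνk)
  have h2 := mul_log_le_assocFun h0 hm hμ hR0 k hkR
  have h3 := assocFun_apply_le h0' hm' hC k
  have hν0 := (pos_of_monotone h0' hm' k).le
  rw [Real.norm_of_nonneg (assocFun_nonneg h0 hm hμ hν0),
    Real.norm_of_nonneg (assocFun_nonneg h0' hm' hν hν0)] at h1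
  have h4 : |K| * (2 * Real.log C) + 1 ≤ Real.log R := by
    rw [Real.le_log_iff_exp_le hR0]
    exact le_max_right _ _
  have hk' : (1 : ℝ) ≤ k := by exact_mod_cast hk
  have h5 : K * assocFun (prodSeq ν) (ν k) ≤ |K| * (k * (2 * Real.log C)) :=
    mul_le_mul (le_abs_self K) h3 (assocFun_nonneg h0' hm' hν hν0) (abs_nonneg K)
  nlinarith

/-- The `k`-th root of the ratio of the products is at most `C ^ 2 * μ k / ν k`, which is
arbitrarily small for suitable `k`. -/
theorem not_le_root_div (h0 : μ 0 = 1) (hm : Monotone μ)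
    (h0' : ν 0 = 1) (hm' : Monotone ν) (hC1 : 1 ≤ C)
    (hC : ∀ k, ν (2 * k) ≤ C * ν k) (hR : ∀ R : ℝ, ∃ k, 1 ≤ k ∧ R * μ k ≤ ν k)
    {c : ℝ} (hc : 0 < c) :
    ¬ ∀ k : ℕ, 1 ≤ k → c ≤ (prodSeq μ k / prodSeq ν k) ^ (1 / (k : ℝ)) := by
  intro h
  obtain ⟨k, hk, hkR⟩ := hR (2 * C ^ 2 / c)
  have hμ := pos_of_monotone h0 hm k
  have hν := pos_of_monotone h0' hm' k
  have hμ' := prodSeq_pos h0 hm k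
  have hν' := prodSeq_pos h0' hm' k
  have hC0 : 0 < C := by linarith
  have h1 : prodSeq μ k / prodSeq ν k ≤ (C ^ 2 * μ k / ν k) ^ k := by
    rw [div_pow, div_le_div_iff₀ hν' (by positivity)]
    calc prodSeq μ k * ν k ^ k ≤ μ k ^ k * (C ^ (2 * k) * prodSeq ν k) :=
          mul_le_mul (prodSeq_le_pow h0 hm k) (pow_le_prodSeq h0' hm' hC k) (by positivity)
            (by positivity)
      _ = _ := by ring
  have h2 : c ≤ C ^ 2 * μ k / ν k := by
    refine (h k hk).trans ((Real.rpow_le_rpow (by positivity) h1 (by positivity)).trans_eq ?_)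
    rw [one_div, Real.pow_rpow_inv_natCast (by positivity) (by omega)]
  rw [le_div_iff₀ hν] at h2
  have h3 : 2 * C ^ 2 * μ k ≤ c * ν k := by
    have := mul_le_mul_of_nonneg_left hkR hc.le
    calc _ = c * (2 * C ^ 2 / c * μ k) := by field_simp
      _ ≤ _ := this
  have : 0 < C ^ 2 * μ k := by positivity
  linarith

/-- Two sequences of quotients whose ratio is unbounded give inequivalent sequences and
inequivalent associated functions, in either order. -/
theorem not_equiv_of_unbounded (h0 : μ 0 = 1) (hm : Monotone μ) (hμ : Tendsto μ atTop atTop)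
    (h0' : ν 0 = 1) (hm' : Monotone ν) (hν : Tendsto ν atTop atTop) (hC1 : 1 ≤ C)
    (hC : ∀ k, ν (2 * k) ≤ C * ν k) (hR : ∀ R : ℝ, ∃ k, 1 ≤ k ∧ R * μ k ≤ ν k) :
    (¬ SeqEquiv (prodSeq μ) (prodSeq ν) ∧ ¬ SeqEquiv (prodSeq ν) (prodSeq μ)) ∧
    ¬ WeightEquiv (assocFun (prodSeq μ)) (assocFun (prodSeq ν)) ∧
    ¬ WeightEquiv (assocFun (prodSeq ν)) (assocFun (prodSeq μ)) := by
  have hO := not_isBigO_assocFun h0 hm hμ h0' hm' hν hC hR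
  refine ⟨⟨?_, ?_⟩, fun h => hO h.2, fun h => hO h.1⟩
  · rintro ⟨c, _, hc, h⟩
    exact not_le_root_div h0 hm h0' hm' hC1 hC hR hc fun k hk => (h k hk).1
  · rintro ⟨c, K, hc, h⟩
    have hK : 0 < K := hc.trans_le ((h 1 le_rfl).1.trans (h 1 le_rfl).2)
    refine not_le_root_div h0 hm h0' hm' hC1 hC hR (inv_pos.2 hK) fun k hk => ?_
    have h1 := prodSeq_pos h0 hm k
    have h2 := prodSeq_pos h0' hm' k
    have h3 := (h k hk).2
    rw [← inv_div, Real.inv_rpow (by positivity)]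
    exact inv_anti₀ (by positivity) h3

/-! ### Failure of almost subadditivity -/

/-- Taking `s = t` and `q = 3 / 2` gives `τ (2t) ≤ 3 τ(t) + C`, which is iterated and carried over
to `σ`. What matters later is that `2 q < 4`. -/
theorem AlmostSubadditive.exists_bound {τ σ : ℝ → ℝ} (hτ : IsWeightFunction τ)
    (hσ : ∀ t, 0 ≤ t → 0 ≤ σ t) (h : WeightEquiv τ σ) (ha : AlmostSubadditive τ) :
    ∃ D t₀ : ℝ, 0 ≤ D ∧ ∀ (n : ℕ) (t : ℝ), t₀ ≤ t → σ (2 ^ n * t) ≤ D * 3 ^ n * σ t := by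
  obtain ⟨K, hK0, hK⟩ := h.2.exists_pos
  obtain ⟨L, hL0, hL⟩ := h.1.exists_pos
  obtain ⟨C, hC1, hC⟩ := ha (3 / 2) (by norm_num)
  obtain ⟨t₀, ht₀⟩ := eventually_atTop.1
    ((hK.bound.and hL.bound).and ((hτ.tendsto.eventually_ge_atTop C).and (eventually_ge_atTop 0)))
  -- The shift by `C / 2` turns the affine recursion into a purely multiplicative one.
  have hind : ∀ (n : ℕ) (t : ℝ), 0 ≤ t → τ (2 ^ n * t) + C / 2 ≤ 3 ^ n * (τ t + C / 2) := by
    intro n t ht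
    induction n with
    | zero => simp
    | succ n ih =>
      have := hC (2 ^ n * t) (2 ^ n * t) (by positivity) (by positivity)
      rw [show (2 : ℝ) ^ (n + 1) * t = 2 ^ n * t + 2 ^ n * t by ring, pow_succ]
      linarith
  refine ⟨2 * K * L, t₀, by positivity, fun n t ht => ?_⟩
  obtain ⟨⟨h1, h2⟩, h3, h4⟩ := ht₀ t ht
  have h2n : (1 : ℝ) ≤ 2 ^ n := one_le_pow₀ one_le_two
  obtain ⟨⟨h5, h6⟩, h7, h8⟩ := ht₀ (2 ^ n * t) (by nlinarith)
  rw [Real.norm_of_nonneg (hσ _ h4), Real.norm_of_nonneg (hτ.nonneg _ h4)] at h1 h2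
  rw [Real.norm_of_nonneg (hσ _ h8), Real.norm_of_nonneg (hτ.nonneg _ h8)] at h5 h6
  have h9 := hind n t h4
  calc σ (2 ^ n * t) ≤ L * τ (2 ^ n * t) := h6
    _ ≤ L * (3 ^ n * (2 * τ t)) := by
        have : (3 : ℝ) ^ n * (τ t + C / 2) ≤ 3 ^ n * (2 * τ t) := by gcongr; linarith
        gcongr
        linarith
    _ ≤ L * (3 ^ n * (2 * (K * σ t))) := by gcongr
    _ = _ := by ring

/-- If `μ` has arbitrarily long stretches on which it grows at most like the square root, then
no weight equivalent to the associated function is almost subadditive. -/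
theorem not_almostSubadditive (h0 : μ 0 = 1) (hm : Monotone μ) (hμ : Tendsto μ atTop atTop)
    (hC : ∀ k, μ (2 * k) ≤ C * μ k)
    (hslow : ∀ (n : ℕ) (R : ℝ), ∃ k, 1 ≤ k ∧ R ≤ μ k ∧ μ (4 ^ n * k) ≤ 2 ^ n * μ k) :
    ¬ ∃ τ : ℝ → ℝ, IsWeightFunction τ ∧ WeightEquiv τ (assocFun (prodSeq μ)) ∧
      AlmostSubadditive τ := by
  rintro ⟨τ, hτ, he, ha⟩
  obtain ⟨D, t₀, hD, h⟩ := ha.exists_bound hτ (fun t ht => assocFun_nonneg h0 hm hμ ht) he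
  have hl2 := Real.log_pos one_lt_two
  -- At `2 ^ (n + 1) * μ k` the lower bound is `4 ^ n k log 2` and the upper bound `D 3 ^ (n + 1) ·
  -- 2 k log C`; this `n` makes them incompatible.
  obtain ⟨n, hn⟩ := pow_unbounded_of_one_lt (6 * D * Real.log C / Real.log 2)
    (show (1 : ℝ) < 4 / 3 by norm_num)
  obtain ⟨k, hk, hkR, hks⟩ := hslow n t₀
  have h1 := h (n + 1) (μ k) hkR
  have h2 := mul_log_le_assocFun h0 hm hμ two_pos (4 ^ n * k) (t := 2 ^ (n + 1) * μ k)
    (by rw [pow_succ]; linarith)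
  have h3 := mul_le_mul_of_nonneg_left (assocFun_apply_le h0 hm hC k)
    (by positivity : 0 ≤ D * 3 ^ (n + 1))
  have hk' : (0 : ℝ) < k := by exact_mod_cast hk
  have h4 : (4 : ℝ) ^ n * Real.log 2 ≤ 6 * D * Real.log C * 3 ^ n := by
    refine le_of_mul_le_mul_left ?_ hk'
    push_cast at h2
    rw [pow_succ 3 n] at h3 h1
    linarith
  rw [div_pow, div_lt_div_iff₀ hl2 (by positivity)] at hn
  linarith

end General

/-! ### Dyadic description of the blocks -/

/-- The exponent of `blockA d (j + 1)` as a power of two. -/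
def blockExp (d : ℕ → ℕ) : ℕ → ℕ
  | 0 => 0
  | j + 1 => blockExp d j + d (j + 1) + (j + 1)

theorem blockA_succ (d : ℕ → ℕ) (j : ℕ) : blockA d (j + 1) = 2 ^ blockExp d j := by
  induction j with
  | zero => rfl
  | succ j ih =>
    rw [blockA, ih, blockExp]
    ring

theorem blockB_succ (d : ℕ → ℕ) (j : ℕ) :
    blockB d (j + 1) = 2 ^ (blockExp d j + d (j + 1)) := by
  rw [blockB, blockA_succ]
  ring

theorem blockExp_mono (d : ℕ → ℕ) : Monotone (blockExp d) :=
  monotone_nat_of_le_succ fun j => by rw [blockExp]; omega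

theorem le_blockExp (d : ℕ → ℕ) (j : ℕ) : j ≤ blockExp d j := by
  induction j with
  | zero => simp
  | succ j ih => rw [blockExp]; omega

theorem exists_block (d : ℕ → ℕ) (n : ℕ) : ∃ j, blockExp d j ≤ n ∧ n < blockExp d (j + 1) := by
  induction n with
  | zero => exact ⟨0, le_rfl, by simp [blockExp]⟩
  | succ n ih =>
    obtain ⟨j, h1, h2⟩ := ih
    rcases Nat.lt_or_ge (n + 1) (blockExp d (j + 1)) with h | h
    · exact ⟨j, by omega, h⟩
    · refine ⟨j + 1, h, ?_⟩
      rw [blockExp]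
      omega

/-- The dyadic interval `(2 ^ n, 2 ^ (n + 1)]` lies in some block `(a_j, b_j]`. -/
def IsFastIndex (d : ℕ → ℕ) (n : ℕ) : Prop :=
  ∃ j, blockExp d j ≤ n ∧ n < blockExp d j + d (j + 1)

theorem isFastIndex_add {d : ℕ → ℕ} {j i : ℕ} (hi : i < d (j + 1)) :
    IsFastIndex d (blockExp d j + i) :=
  ⟨j, by omega, by omega⟩

theorem not_isFastIndex_add {d : ℕ → ℕ} {j i : ℕ} (hi : i < j + 1) :
    ¬ IsFastIndex d (blockExp d j + d (j + 1) + i) := by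
  rintro ⟨l, h1, h2⟩
  have e : blockExp d (j + 1) = blockExp d j + d (j + 1) + (j + 1) := rfl
  rcases lt_trichotomy l j with h | rfl | h
  · have h3 := blockExp_mono d (Nat.succ_le_of_lt h)
    rw [Nat.succ_eq_add_one, blockExp] at h3
    omega
  · omega
  · have h3 := blockExp_mono d (show j + 1 ≤ l from h)
    omega

open Classical in
/-- The factor by which the block quotients grow over `(2 ^ n, 2 ^ (n + 1)]`. -/
noncomputable def dyadicFactor (A : ℝ) (d : ℕ → ℕ) (n : ℕ) : ℝ :=
  if IsFastIndex d n then A else √2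

/-- The value of the block quotients at `2 ^ n`. -/
noncomputable def dyadicValue (A : ℝ) (d : ℕ → ℕ) : ℕ → ℝ
  | 0 => 2
  | n + 1 => dyadicFactor A d n * dyadicValue A d n

open Classical in
/-- The explicit solution of the block construction. -/
noncomputable def blockQuotient (A : ℝ) (d : ℕ → ℕ) (k : ℕ) : ℝ :=
  if k = 0 then 1 else if k = 1 then 2 else
    let n := Nat.log 2 (k - 1)
    (if IsFastIndex d n then A else √2 ^ (((k : ℝ) - 2 ^ n) / 2 ^ n)) * dyadicValue A d n

section Block

variable {A : ℝ} {d : ℕ → ℕ}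

theorem blockQuotient_of_mem {n k : ℕ} (h1 : 2 ^ n < k) (h2 : k ≤ 2 ^ (n + 1)) :
    blockQuotient A d k =
      (open Classical in if IsFastIndex d n then A else √2 ^ (((k : ℝ) - 2 ^ n) / 2 ^ n)) *
        dyadicValue A d n := by
  have h3 : 1 ≤ 2 ^ n := Nat.one_le_two_pow
  -- The shift to `k - 1` fits intervals that are open on the left and closed on the right.
  have hlog : Nat.log 2 (k - 1) = n :=
    (Nat.log_eq_iff (Or.inr ⟨by norm_num, by omega⟩)).2 ⟨by omega, by omega⟩
  rw [blockQuotient, if_neg (by omega), if_neg (by omega), hlog]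

theorem blockQuotient_two_pow (n : ℕ) : blockQuotient A d (2 ^ n) = dyadicValue A d n := by
  cases n with
  | zero => simp [blockQuotient, dyadicValue]
  | succ n =>
    rw [blockQuotient_of_mem (Nat.pow_lt_pow_right (by norm_num) n.lt_succ_self) le_rfl,
      dyadicValue, dyadicFactor]
    congr 1
    have : (((2 ^ (n + 1) : ℕ) : ℝ) - 2 ^ n) / 2 ^ n = 1 := by
      push_cast
      rw [pow_succ]
      field_simp
      ring
    rw [this, Real.rpow_one]

theorem exists_dyadic {k : ℕ} (hk : 2 ≤ k) : ∃ n, 2 ^ n < k ∧ k ≤ 2 ^ (n + 1) := by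
  have h1 := Nat.pow_log_le_self 2 (x := k - 1) (by omega)
  have h2 := Nat.lt_pow_succ_log_self (b := 2) (by norm_num) (k - 1)
  exact ⟨Nat.log 2 (k - 1), by omega, by omega⟩

theorem isBlockQuotient_blockQuotient (A : ℝ) (d : ℕ → ℕ) :
    IsBlockQuotient A d (blockQuotient A d) where
  zero := by simp [blockQuotient]
  one := by simp [blockQuotient, blockA]
  fast j i k hj hi h1 h2 := by
    obtain ⟨j, rfl⟩ : ∃ l, j = l + 1 := ⟨j - 1, by omega⟩
    rw [blockA_succ, ← pow_add] at h1 h2 ⊢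
    rw [add_comm i] at h1 ⊢
    rw [blockQuotient_of_mem h1 (by convert h2 using 2; ring), if_pos (isFastIndex_add hi),
      blockQuotient_two_pow]
  slow j i k hj hi h1 h2 := by
    obtain ⟨j, rfl⟩ : ∃ l, j = l + 1 := ⟨j - 1, by omega⟩
    rw [blockB_succ, ← pow_add] at h1 h2
    rw [add_comm i] at h1
    have h2' : k ≤ 2 ^ (blockExp d j + d (j + 1) + i + 1) := by convert h2 using 2; ring
    have hc : (2 : ℝ) ^ i * (blockB d (j + 1) : ℝ) = 2 ^ (blockExp d j + d (j + 1) + i) := by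
      rw [blockB_succ]
      push_cast
      ring
    rw [hc]
    have hnf := not_isFastIndex_add (d := d) hi
    set n := blockExp d j + d (j + 1) + i
    rw [blockQuotient_of_mem h1 h2', if_neg hnf]
    have hs : (0 : ℝ) < √2 := by positivity
    have h2n : (0 : ℝ) < 2 ^ n := by positivity
    rcases (Nat.succ_le_of_lt h1).eq_or_lt with h | h
    · have hk : k - 1 = 2 ^ n := by omega
      rw [hk, blockQuotient_two_pow, ← h]
      congr 2
      push_cast
      ring
    · rw [blockQuotient_of_mem (n := n) (by omega) (by omega), if_neg hnf, ← mul_assoc,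
        ← Real.rpow_add hs]
      congr 2
      rw [Nat.cast_sub (by omega)]
      push_cast
      ring

/-- Every `k ≥ 2` lies in a dyadic interval of a fast or a slow stretch, where the rule expresses `μ
k` through a smaller index. -/
theorem IsBlockQuotient.eq_blockQuotient {μ : ℕ → ℝ} (h : IsBlockQuotient A d μ) :
    μ = blockQuotient A d := by
  have h' := isBlockQuotient_blockQuotient A d
  funext k
  induction k using Nat.strong_induction_on with
  | _ k ih =>
    rcases Nat.lt_or_ge k 2 with hk | hk
    · interval_cases k
      · rw [h.zero, h'.zero]
      · exact h.one.trans h'.one.symm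
    · obtain ⟨n, h1, h2⟩ := exists_dyadic hk
      obtain ⟨j, hj1, hj2⟩ := exists_block d n
      rcases Nat.lt_or_ge n (blockExp d j + d (j + 1)) with hn | hn
      · have e : 2 ^ (n - blockExp d j) * blockA d (j + 1) = 2 ^ n := by
          rw [blockA_succ, ← pow_add]; congr 1; omega
        have e' : 2 ^ (n - blockExp d j + 1) * blockA d (j + 1) = 2 ^ (n + 1) := by
          rw [blockA_succ, ← pow_add]; congr 1; omega
        rw [h.fast (j + 1) (n - blockExp d j) k (by omega) (by omega) (e ▸ h1) (e' ▸ h2),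
          h'.fast (j + 1) (n - blockExp d j) k (by omega) (by omega) (e ▸ h1) (e' ▸ h2), e,
          ih _ h1]
      · rw [blockExp] at hj2
        set i := n - (blockExp d j + d (j + 1)) with hi
        have e : 2 ^ i * blockB d (j + 1) = 2 ^ n := by
          rw [blockB_succ, ← pow_add]; congr 1; omega
        have e' : 2 ^ (i + 1) * blockB d (j + 1) = 2 ^ (n + 1) := by
          rw [blockB_succ, ← pow_add]; congr 1; omega
        rw [h.slow (j + 1) i k (by omega) (by omega) (e ▸ h1) (e' ▸ h2),
          h'.slow (j + 1) i k (by omega) (by omega) (e ▸ h1) (e' ▸ h2), ih (k - 1) (by omega)]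

theorem isBlockSequence_iff {M : ℕ → ℝ} :
    IsBlockSequence A d M ↔ M = prodSeq (blockQuotient A d) := by
  constructor
  · rintro ⟨μ, h1, h2⟩
    rw [← h1.eq_blockQuotient]
    exact funext h2
  · rintro rfl
    exact ⟨_, isBlockQuotient_blockQuotient A d, fun _ => rfl⟩

theorem dyadicFactor_fast {j i : ℕ} (hi : i < d (j + 1)) :
    dyadicFactor A d (blockExp d j + i) = A :=
  if_pos (isFastIndex_add hi)

theorem dyadicFactor_slow {j i : ℕ} (hi : i < j + 1) :
    dyadicFactor A d (blockExp d j + d (j + 1) + i) = √2 :=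
  if_neg (not_isFastIndex_add hi)

theorem dyadicValue_fast {j i : ℕ} (hi : i ≤ d (j + 1)) :
    dyadicValue A d (blockExp d j + i) = A ^ i * dyadicValue A d (blockExp d j) := by
  induction i with
  | zero => simp
  | succ i ih =>
    rw [← add_assoc, dyadicValue, dyadicFactor_fast hi, ih (by omega)]
    ring

theorem dyadicValue_slow {j i : ℕ} (hi : i ≤ j + 1) :
    dyadicValue A d (blockExp d j + d (j + 1) + i) =
      √2 ^ i * dyadicValue A d (blockExp d j + d (j + 1)) := by
  induction i with
  | zero => simp
  | succ i ih =>
    rw [← add_assoc, dyadicValue, dyadicFactor_slow hi, ih (by omega)]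
    ring

/-! ### Growth bounds for the block quotients -/

theorem sqrt_two_le_dyadicFactor (hA : 2 < A) (n : ℕ) : √2 ≤ dyadicFactor A d n := by
  rw [dyadicFactor]
  split_ifs
  · refine le_trans ?_ hA.le
    rw [Real.sqrt_le_left (by norm_num)]
    norm_num
  · rfl

theorem dyadicFactor_le (hA : 2 < A) (n : ℕ) : dyadicFactor A d n ≤ A := by
  rw [dyadicFactor]
  split_ifs
  · rfl
  · refine le_trans ?_ hA.le
    rw [Real.sqrt_le_left (by norm_num)]
    norm_num

theorem sqrt_two_pow_le_dyadicValue (hA : 2 < A) (n : ℕ) : √2 ^ n ≤ dyadicValue A d n := by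
  induction n with
  | zero => simp [dyadicValue]
  | succ n ih =>
    rw [dyadicValue, pow_succ, mul_comm]
    exact mul_le_mul (sqrt_two_le_dyadicFactor hA n) ih (by positivity)
      (le_trans (by positivity) (sqrt_two_le_dyadicFactor hA n))

theorem dyadicValue_pos (hA : 2 < A) (n : ℕ) : 0 < dyadicValue A d n :=
  lt_of_lt_of_le (by positivity) (sqrt_two_pow_le_dyadicValue hA n)

theorem one_lt_sqrt_two : 1 < √2 := by
  rw [Real.lt_sqrt] <;> norm_num

theorem blockQuotient_zero : blockQuotient A d 0 = 1 := by simp [blockQuotient]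

theorem blockQuotient_monotone (hA : 2 < A) : Monotone (blockQuotient A d) := by
  refine monotone_nat_of_le_succ fun k => ?_
  rcases Nat.eq_zero_or_pos k with rfl | hk
  · simp [blockQuotient]
  obtain ⟨n, h1, h2⟩ := exists_dyadic (show 2 ≤ k + 1 by omega)
  have hpos := dyadicValue_pos (d := d) hA n
  rcases (Nat.le_of_lt_succ h1).eq_or_lt with rfl | h
  · rw [blockQuotient_two_pow, blockQuotient_of_mem h1 h2]
    refine le_mul_of_one_le_left hpos.le ?_
    split_ifs
    · linarith
    · refine Real.one_le_rpow one_lt_sqrt_two.le ?_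
      push_cast
      ring_nf
      positivity
  · rw [blockQuotient_of_mem h (by omega), blockQuotient_of_mem h1 h2]
    refine mul_le_mul_of_nonneg_right ?_ hpos.le
    split_ifs
    · rfl
    · refine Real.rpow_le_rpow_of_exponent_le one_lt_sqrt_two.le ?_
      push_cast
      gcongr
      linarith

theorem blockQuotient_tendsto (hA : 2 < A) : Tendsto (blockQuotient A d) atTop atTop := by
  refine tendsto_atTop_mono' (f₁ := fun k => √2 ^ Nat.log 2 k) atTop ?_ ?_
  · filter_upwards [eventually_ge_atTop 1] with k hk
    refine (sqrt_two_pow_le_dyadicValue (d := d) hA _).trans ?_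
    rw [← blockQuotient_two_pow]
    exact blockQuotient_monotone hA (Nat.pow_log_le_self 2 (by omega))
  · exact (tendsto_pow_atTop_atTop_of_one_lt one_lt_sqrt_two).comp
      (tendsto_atTop_atTop_of_monotone Nat.log_monotone fun b => ⟨2 ^ b, by
        rw [Nat.log_pow one_lt_two]⟩)

theorem exists_dyadicValue_le (hA : 2 < A) {k : ℕ} (hk : 1 ≤ k) : ∃ n,
    2 ^ n ≤ k ∧ k ≤ 2 ^ (n + 1) ∧ dyadicValue A d n ≤ blockQuotient A d k ∧
      blockQuotient A d k ≤ dyadicValue A d (n + 1) := by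
  have h1 := Nat.pow_log_le_self 2 (x := k) (by omega)
  have h2 := Nat.lt_pow_succ_log_self (b := 2) (by norm_num) k
  refine ⟨Nat.log 2 k, h1, h2.le, ?_, ?_⟩
  · rw [← blockQuotient_two_pow]
    exact blockQuotient_monotone hA h1
  · rw [← blockQuotient_two_pow]
    exact blockQuotient_monotone hA h2.le

theorem blockQuotient_two_mul_le (hA : 2 < A) (k : ℕ) :
    blockQuotient A d (2 * k) ≤ A ^ 2 * blockQuotient A d k := by
  rcases Nat.eq_zero_or_pos k with rfl | hk
  · rw [mul_zero, blockQuotient_zero]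
    nlinarith
  obtain ⟨n, h1, h2, h3, h4⟩ := exists_dyadicValue_le (d := d) hA hk
  have h5 : blockQuotient A d (2 * k) ≤ dyadicValue A d (n + 2) := by
    rw [← blockQuotient_two_pow]
    refine blockQuotient_monotone hA ?_
    rw [pow_succ _ (n + 1)]
    omega
  have f := fun n => dyadicFactor_le (d := d) hA n
  have g := fun n => (dyadicValue_pos (d := d) hA n).le
  refine h5.trans ?_
  rw [dyadicValue, dyadicValue]
  calc _ ≤ A * (A * dyadicValue A d n) :=
        mul_le_mul (f _) (mul_le_mul_of_nonneg_right (f _) (g _)) (g (n + 1)) (by linarith)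
    _ = A ^ 2 * dyadicValue A d n := by ring
    _ ≤ _ := by gcongr

/-- Between `k` and `4 k` there is always a complete dyadic interval, and each contributes at least
`√2`. -/
theorem sqrt_two_mul_blockQuotient_le (hA : 2 < A) {k : ℕ} (hk : 1 ≤ k) :
    √2 * blockQuotient A d k ≤ blockQuotient A d (4 * k) := by
  obtain ⟨n, h1, h2, h3, h4⟩ := exists_dyadicValue_le (d := d) hA hk
  have h5 : dyadicValue A d (n + 2) ≤ blockQuotient A d (4 * k) := by
    rw [← blockQuotient_two_pow]
    refine blockQuotient_monotone hA ?_
    rw [pow_add]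
    omega
  refine le_trans ?_ h5
  rw [dyadicValue]
  have g := dyadicValue_pos (d := d) hA (n + 1)
  exact mul_le_mul (sqrt_two_le_dyadicFactor hA (n + 1)) h4
    ((dyadicValue_pos hA n).le.trans h3) (le_trans (by positivity) (sqrt_two_le_dyadicFactor hA _))

theorem two_mul_blockQuotient_le (hA : 2 < A) {k : ℕ} (hk : 1 ≤ k) :
    2 * blockQuotient A d k ≤ blockQuotient A d (16 * k) := by
  have h1 := sqrt_two_mul_blockQuotient_le (d := d) hA hk
  have h2 := sqrt_two_mul_blockQuotient_le (d := d) hA (show 1 ≤ 4 * k by omega)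
  rw [← mul_assoc] at h2
  calc 2 * blockQuotient A d k = √2 * (√2 * blockQuotient A d k) := by
        rw [← mul_assoc, Real.mul_self_sqrt zero_le_two]
    _ ≤ √2 * blockQuotient A d (4 * k) := by gcongr
    _ ≤ _ := h2

theorem betaThree_blockQuotient (hA : 2 < A) : BetaThree (prodSeq (blockQuotient A d)) := by
  refine ⟨4, by norm_num, ?_⟩
  have hm := blockQuotient_monotone (d := d) hA
  rw [quotientSeq_prodSeq blockQuotient_zero hm]
  refine lt_of_lt_of_le (b := ((√2 : ℝ) : EReal)) (by exact_mod_cast one_lt_sqrt_two) ?_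
  refine le_liminf_of_le (h := ?_)
  filter_upwards [eventually_ge_atTop 1] with k hk
  rw [EReal.coe_le_coe_iff, le_div_iff₀ (pos_of_monotone blockQuotient_zero hm k)]
  exact sqrt_two_mul_blockQuotient_le hA hk

theorem IsAdmissible.mono {A' : ℝ} (h : IsAdmissible A d) (hA : 0 < A)
    (hAA' : A ≤ A') : IsAdmissible A' d where
  strictMono := h.strictMono
  one := h.one
  growth j hj := by
    refine le_trans ?_ (h.growth j hj)
    have := hA.trans_le hAA'
    gcongr

theorem IsAdmissible.le_apply (h : IsAdmissible A d) (j : ℕ) : j + 1 ≤ d (j + 1) := by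
  induction j with
  | zero => exact h.one
  | succ j ih =>
    have := h.strictMono (show j + 1 ∈ Ici 1 by simp) (show j + 1 + 1 ∈ Ici 1 by simp)
      (Nat.lt_succ_self _)
    omega

theorem exists_isAdmissible (hA : 2 < A) : ∃ d : ℕ → ℕ, IsAdmissible A d := by
  have hr : 2 / A < 1 := by rw [div_lt_one] <;> linarith
  have hr0 : 0 < 2 / A := div_pos two_pos (by linarith)
  -- With `d j = m * j` the power is at most `4 ^ (-j)`, and `2 j ≥ j / 2 + 1` for `j ≥ 1`.
  obtain ⟨m, hm⟩ := exists_pow_lt_of_lt_one (show (0 : ℝ) < 1 / 4 by norm_num) hr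
  have hm1 : 1 ≤ m := by
    rcases Nat.eq_zero_or_pos m with rfl | h
    · norm_num at hm
    · exact h
  refine ⟨fun j => m * j, ⟨fun i _ j _ hij => Nat.mul_lt_mul_of_pos_left hij hm1, by simpa, ?_⟩⟩
  intro j hj
  have hj' : (1 : ℝ) ≤ j := by exact_mod_cast hj
  calc (2 / A) ^ (m * j) = ((2 / A) ^ m) ^ j := pow_mul _ _ _
    _ ≤ (1 / 4) ^ j := by gcongr
    _ = 1 / (2 : ℝ) ^ (2 * (j : ℝ)) := by
        rw [Real.rpow_mul zero_le_two, Real.rpow_natCast, one_div_pow]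
        norm_num
    _ ≤ _ := by
        gcongr
        · norm_num
        · linarith

/-- The terms fall by the factor `2 / A` on fast stretches and rise by `√2` on slow ones, so each
block sum is bounded by a multiple of its first term; these first terms at least halve from block to
block. -/
theorem summable_two_pow_div_dyadicValue (hA : 2 < A) (hd : IsAdmissible A d) :
    Summable fun n => 2 ^ n / dyadicValue A d n := by
  set h : ℕ → ℝ := fun n => 2 ^ n / dyadicValue A d n with hh
  have hpos : ∀ n, 0 < h n := fun n => div_pos (by positivity) (dyadicValue_pos hA n)
  have hA0 : 0 < A := by linarith
  set r := 2 / A with hr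
  have hr1 : 0 < 1 - r := by
    rw [hr, sub_pos, div_lt_one] <;> linarith
  have hr0 : 0 < r := by positivity
  have hs : 0 < √2 - 1 := sub_pos.2 one_lt_sqrt_two
  have hfast : ∀ j i, i ≤ d (j + 1) → h (blockExp d j + i) = r ^ i * h (blockExp d j) := by
    intro j i hi
    simp only [hh, dyadicValue_fast hi, hr]
    rw [pow_add, div_pow]
    field_simp
  have hslow : ∀ j i, i ≤ j + 1 → h (blockExp d j + d (j + 1) + i) =
      √2 ^ i * h (blockExp d j + d (j + 1)) := by
    intro j i hi
    simp only [hh, dyadicValue_slow hi]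
    have h2 : (2 : ℝ) ^ i = √2 ^ i * √2 ^ i := by
      rw [← mul_pow, Real.mul_self_sqrt zero_le_two]
    rw [pow_add, h2]
    field_simp
  have hhalf : ∀ j, h (blockExp d (j + 1)) ≤ h (blockExp d j) / 2 := by
    intro j
    rw [blockExp, hslow j _ le_rfl, hfast j _ le_rfl]
    have h1 := hd.growth (j + 1) (by omega)
    have h2 : (2 : ℝ) ^ (((j + 1 : ℕ) : ℝ) / 2 + 1) = √2 ^ (j + 1) * 2 := by
      rw [Real.rpow_add two_pos, Real.rpow_one, Real.sqrt_eq_rpow, ← Real.rpow_natCast,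
        ← Real.rpow_mul zero_le_two]
      congr 2
      ring
    rw [h2, le_div_iff₀ (by positivity)] at h1
    have := hpos (blockExp d j)
    nlinarith
  set C := 1 / (1 - r) + 1 / (√2 - 1) with hC
  -- Halving gives `h (a_j) ≤ 2 (h (a_j) - h (a_{j+1}))` at the block starts, so the block estimates
  -- telescope.
  have hbound : ∀ j, ∑ n ∈ Finset.range (blockExp d j), h n ≤
      2 * C * (h 0 - h (blockExp d j)) := by
    intro j
    induction j with
    | zero => simp [blockExp]
    | succ j ih =>
      have hj := hpos (blockExp d j)
      have e1 : ∑ i ∈ Finset.range (d (j + 1)), h (blockExp d j + i) ≤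
          1 / (1 - r) * h (blockExp d j) := by
        rw [Finset.sum_congr rfl fun i hi => hfast j i (Finset.mem_range.1 hi).le,
          ← Finset.sum_mul]
        refine mul_le_mul_of_nonneg_right ?_ hj.le
        rw [le_div_iff₀ hr1, geom_sum_mul_neg]
        linarith [pow_pos hr0 (d (j + 1))]
      have e2 : ∑ i ∈ Finset.range (j + 1), h (blockExp d j + d (j + 1) + i) ≤
          1 / (√2 - 1) * h (blockExp d j) := by
        rw [Finset.sum_congr rfl fun i hi => hslow j i (Finset.mem_range.1 hi).le,
          ← Finset.sum_mul, one_div_mul_eq_div, le_div_iff₀ hs, mul_right_comm, geom_sum_mul]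
        have := hhalf j
        rw [blockExp, hslow j _ le_rfl] at this
        nlinarith [hpos (blockExp d j + d (j + 1))]
      have e3 := hhalf j
      have hC0 : 0 < C := by positivity
      rw [show Finset.range (blockExp d (j + 1)) =
        Finset.range (blockExp d j + d (j + 1) + (j + 1)) from rfl, Finset.sum_range_add,
        Finset.sum_range_add]
      have e4 : C * h (blockExp d j) ≤ 2 * C * (h (blockExp d j) - h (blockExp d (j + 1))) := by
        nlinarith
      have e5 : 1 / (1 - r) * h (blockExp d j) + 1 / (√2 - 1) * h (blockExp d j) =
        C * h (blockExp d j) := by rw [hC]; ring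
      linarith
  have hC0 : 0 < C := by positivity
  refine summable_of_sum_range_le (c := 2 * C * h 0) (fun n => (hpos n).le) fun n => ?_
  calc _ ≤ ∑ n ∈ Finset.range (blockExp d n), h n :=
        Finset.sum_le_sum_of_subset_of_nonneg (by simpa using le_blockExp d n)
          fun i _ _ => (hpos i).le
    _ ≤ _ := hbound n
    _ ≤ _ := by
        have := hpos (blockExp d n)
        gcongr
        linarith

theorem summable_one_div_blockQuotient (hA : 2 < A) (hd : IsAdmissible A d) :
    Summable fun k => 1 / blockQuotient A d (k + 1) := by
  have hm := blockQuotient_monotone (d := d) hA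
  have hp := pos_of_monotone blockQuotient_zero hm
  rw [summable_nat_add_iff 1 (f := fun k => 1 / blockQuotient A d k),
    ← summable_condensed_iff_of_nonneg (fun n => (one_div_pos.2 (hp n)).le)
      (fun m n _ hmn => one_div_le_one_div_of_le (hp m) (hm hmn))]
  simpa only [blockQuotient_two_pow, mul_one_div] using summable_two_pow_div_dyadicValue hA hd

/-- The index is in fact at most `1 / 2`: over a slow stretch of `j + 1` dyadic steps a comparable
`ν` gains at most `a ^ 2 * √2 ^ (j + 1)`, whereas monotonicity of `ν_k / k ^ γ` demands `2 ^ (γ (j +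
1))`. -/
theorem growthIndexSeq_blockQuotient_lt (hA : 2 < A) :
    growthIndexSeq (prodSeq (blockQuotient A d)) < 1 := by
  refine lt_of_le_of_lt (b := ((1 / 2 : ℝ) : EReal)) (iSup₂_le ?_)
    (by exact_mod_cast one_half_lt_one)
  rintro γ ⟨ν, ⟨a, ha, hν⟩, hmono⟩
  rw [EReal.coe_le_coe_iff]
  by_contra! hγ
  rw [quotientSeq_prodSeq blockQuotient_zero (blockQuotient_monotone hA)] at hν
  have hs : (0 : ℝ) < √2 := by positivity
  have hq : 1 < 2 ^ γ / √2 := by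
    rw [one_lt_div hs, Real.sqrt_eq_rpow]
    exact Real.rpow_lt_rpow_of_exponent_lt one_lt_two hγ
  obtain ⟨j, hj⟩ := pow_unbounded_of_one_lt (a ^ 2) hq
  have hj' := hj.trans_le (pow_le_pow_right₀ hq.le j.le_succ)
  set m := blockExp d j + d (j + 1) with hmdef
  have h1 := hmono (show 2 ^ m ∈ Ici 1 from Nat.one_le_two_pow)
    (show 2 ^ (m + (j + 1)) ∈ Ici 1 from Nat.one_le_two_pow)
    (Nat.pow_le_pow_right (by norm_num) (Nat.le_add_right _ _))
  have h2 := (hν (2 ^ m) Nat.one_le_two_pow).1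
  have h3 := (hν (2 ^ (m + (j + 1))) Nat.one_le_two_pow).2
  rw [blockQuotient_two_pow] at h2 h3
  rw [dyadicValue_slow le_rfl] at h3
  have hG := dyadicValue_pos (d := d) hA m
  have e : ∀ n : ℕ, ((2 ^ n : ℕ) : ℝ) ^ γ = ((2 : ℝ) ^ γ) ^ n := by
    intro n
    push_cast
    rw [← Real.rpow_natCast, ← Real.rpow_natCast, ← Real.rpow_mul zero_le_two,
      ← Real.rpow_mul zero_le_two, mul_comm]
  have h2γ : (0 : ℝ) < 2 ^ γ := by positivity
  simp only [e] at h1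
  rw [pow_add ((2 : ℝ) ^ γ) m (j + 1), div_le_div_iff₀ (by positivity) (by positivity)] at h1
  have h4 : ν (2 ^ m) * (2 ^ γ) ^ (j + 1) ≤ ν (2 ^ (m + (j + 1))) := by
    refine le_of_mul_le_mul_right ?_ (pow_pos h2γ m)
    linarith
  have h5 : a⁻¹ * dyadicValue A d m * (2 ^ γ) ^ (j + 1) ≤
      a * (√2 ^ (j + 1) * dyadicValue A d m) :=
    (mul_le_mul_of_nonneg_right h2 (by positivity)).trans (h4.trans h3)
  have ha0 : 0 < a := by linarith
  rw [div_pow, lt_div_iff₀ (by positivity)] at hj'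
  have h6 : (2 ^ γ : ℝ) ^ (j + 1) ≤ a ^ 2 * √2 ^ (j + 1) := by
    refine le_of_mul_le_mul_left ?_ (by positivity : 0 < a⁻¹ * dyadicValue A d m)
    refine h5.trans_eq ?_
    field_simp
  exact absurd hj' (not_lt.2 h6)

theorem blockQuotient_slow (hA : 2 < A) (n : ℕ) (R : ℝ) : ∃ k, 1 ≤ k ∧
    R ≤ blockQuotient A d k ∧ blockQuotient A d (4 ^ n * k) ≤ 2 ^ n * blockQuotient A d k := by
  obtain ⟨l, hl⟩ := pow_unbounded_of_one_lt R one_lt_sqrt_two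
  -- `2 * n` makes the slow stretch long enough for `4 ^ n`, and `l` makes its initial value exceed
  -- `R`.
  set j := max (2 * n) l
  refine ⟨2 ^ (blockExp d j + d (j + 1)), Nat.one_le_two_pow, ?_, ?_⟩
  · rw [blockQuotient_two_pow]
    refine hl.le.trans (le_trans ?_ (sqrt_two_pow_le_dyadicValue hA _))
    refine pow_le_pow_right₀ one_lt_sqrt_two.le ?_
    exact (le_max_right _ _).trans ((le_blockExp d j).trans (Nat.le_add_right _ _))
  · have e : 4 ^ n * 2 ^ (blockExp d j + d (j + 1)) = 2 ^ (blockExp d j + d (j + 1) + 2 * n) := by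
      rw [pow_add _ _ (2 * n), pow_mul]
      norm_num [mul_comm]
    have hn : 2 * n ≤ j + 1 := (le_max_left _ _).trans (Nat.le_succ _)
    rw [e, blockQuotient_two_pow, blockQuotient_two_pow, dyadicValue_slow hn, pow_mul,
      Real.sq_sqrt zero_le_two]

/-- The ratio never decreases along powers of two, and the fast stretch ending at `b_j` alone
multiplies it by `(A' / A) ^ d_j`. -/
theorem blockQuotient_ratio_unbounded {A' : ℝ} (hA : 2 < A) (hAA' : A < A')
    (hd : IsAdmissible A d) (R : ℝ) :
    ∃ k, 1 ≤ k ∧ R * blockQuotient A d k ≤ blockQuotient A' d k := by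
  have hA0 : 0 < A := by linarith
  have hp := fun n => dyadicValue_pos (d := d) hA n
  have hle : ∀ n, dyadicValue A d n ≤ dyadicValue A' d n := by
    intro n
    induction n with
    | zero => rfl
    | succ n ih =>
      rw [dyadicValue, dyadicValue]
      have h1 : dyadicFactor A d n ≤ dyadicFactor A' d n := by
        rw [dyadicFactor, dyadicFactor]
        split_ifs
        · exact hAA'.le
        · rfl
      exact mul_le_mul h1 ih (hp n).le
        (le_trans (by positivity) (sqrt_two_le_dyadicFactor (hA.trans hAA') n))
  have hq : 1 < A' / A := (one_lt_div hA0).2 hAA'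
  obtain ⟨j, hj⟩ := pow_unbounded_of_one_lt R hq
  have hR : R ≤ (A' / A) ^ d (j + 1) :=
    hj.le.trans (pow_le_pow_right₀ hq.le ((Nat.le_succ j).trans (hd.le_apply j)))
  refine ⟨2 ^ (blockExp d j + d (j + 1)), Nat.one_le_two_pow, ?_⟩
  rw [blockQuotient_two_pow, blockQuotient_two_pow, dyadicValue_fast le_rfl,
    dyadicValue_fast le_rfl]
  have h1 := hp (blockExp d j)
  calc _ ≤ (A' / A) ^ d (j + 1) * (A ^ d (j + 1) * dyadicValue A d (blockExp d j)) := by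
        gcongr
    _ = A' ^ d (j + 1) * dyadicValue A d (blockExp d j) := by
        rw [div_pow]
        field_simp
    _ ≤ _ := by
        have := hA0.trans hAA'
        gcongr
        exact hle _

/-! ### Assembly of the family -/

theorem block_properties (hA : 2 < A) (hd : IsAdmissible A d) {M : ℕ → ℝ}
    (hM : IsBlockSequence A d M) :
    IsLC M ∧ NonQuasianalyticSeq M ∧ ModerateGrowth M ∧ BetaThree M ∧
      growthIndexSeq M < 1 ∧ AssocFinite M ∧
      IsBMTWeight (assocFun M) ∧ IsNormalizedWeight (assocFun M) ∧
      IsNonQuasianalyticWeight (assocFun M) ∧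
      ¬ ∃ τ : ℝ → ℝ, IsWeightFunction τ ∧ WeightEquiv τ (assocFun M) ∧
        AlmostSubadditive τ := by
  obtain rfl := isBlockSequence_iff.1 hM
  have h0 := blockQuotient_zero (A := A) (d := d)
  have hm := blockQuotient_monotone (d := d) hA
  have hμ := blockQuotient_tendsto (d := d) hA
  have hC := fun k => blockQuotient_two_mul_le (d := d) hA k
  have hs := summable_one_div_blockQuotient hA hd
  refine ⟨isLC_prodSeq h0 hm hμ, ?_, moderateGrowth_prodSeq h0 hm (by nlinarith) hC,
    betaThree_blockQuotient hA, growthIndexSeq_blockQuotient_lt hA,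
    assocFinite_prodSeq h0 hm hμ,
    isBMTWeight_assocFun h0 hm hμ fun k hk => two_mul_blockQuotient_le hA hk,
    assocFun_normalized h0 hm hμ, assocFun_nonQuasianalytic h0 hm hμ hs,
    not_almostSubadditive h0 hm hμ hC fun n R => blockQuotient_slow hA n R⟩
  rw [NonQuasianalyticSeq, quotientSeq_prodSeq h0 hm]
  exact hs

theorem block_not_equiv {A₀ A' : ℝ} (hA₀ : 2 < A₀) (hd : IsAdmissible A₀ d) (hA : A₀ ≤ A)
    (hA' : A₀ ≤ A') (hne : A ≠ A') {M M' : ℕ → ℝ} (hM : IsBlockSequence A d M)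
    (hM' : IsBlockSequence A' d M') :
    ¬ SeqEquiv M M' ∧ ¬ WeightEquiv (assocFun M) (assocFun M') := by
  obtain rfl := isBlockSequence_iff.1 hM
  obtain rfl := isBlockSequence_iff.1 hM'
  have key : ∀ {B B' : ℝ}, A₀ ≤ B → B < B' → _ := fun {B B'} hB hBB' =>
    have hB2 : 2 < B := hA₀.trans_le hB
    have hB2' : 2 < B' := hB2.trans hBB'
    not_equiv_of_unbounded (blockQuotient_zero (A := B) (d := d)) (blockQuotient_monotone hB2)
      (blockQuotient_tendsto hB2) (blockQuotient_zero (A := B') (d := d))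
      (blockQuotient_monotone hB2') (blockQuotient_tendsto hB2') (C := B' ^ 2) (by nlinarith)
      (blockQuotient_two_mul_le hB2')
      (blockQuotient_ratio_unbounded hB2 hBB' (hd.mono (by linarith) hB))
  rcases hne.lt_or_gt with h | h
  · obtain ⟨⟨h1, _⟩, h2, _⟩ := key hA h
    exact ⟨h1, h2⟩
  · obtain ⟨⟨_, h1⟩, _, h2⟩ := key hA' h
    exact ⟨h1, h2⟩

theorem SeqEquiv.refl {M : ℕ → ℝ} (hM : ∀ j, 0 < M j) : SeqEquiv M M :=
  ⟨1, 1, one_pos, fun j _ => by simp [div_self (hM j).ne']⟩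

end Block

theorem theorem3p7 :
    -- existence of an uncountable family of pairwise non-equivalent examples
    (∃ F : Set (ℕ → ℝ), ¬ F.Countable ∧
      (∀ M ∈ F,
        IsLC M ∧ AssocFinite M ∧
        IsBMTWeight (assocFun M) ∧ IsNormalizedWeight (assocFun M) ∧
        IsNonQuasianalyticWeight (assocFun M) ∧
        ¬ ∃ τ : ℝ → ℝ, IsWeightFunction τ ∧ WeightEquiv τ (assocFun M) ∧ AlmostSubadditive τ) ∧
      (∀ M ∈ F, ∀ N ∈ F, M ≠ N →
        ¬ SeqEquiv M N ∧ ¬ WeightEquiv (assocFun M) (assocFun N))) ∧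
    -- the explicit examples
    (∀ A₀ : ℝ, 2 < A₀ →
      (∃ d : ℕ → ℕ, IsAdmissible A₀ d) ∧
      ∀ d : ℕ → ℕ, IsAdmissible A₀ d →
        (∀ A : ℝ, A₀ ≤ A → ∃! M : ℕ → ℝ, IsBlockSequence A d M) ∧
        (∀ A : ℝ, A₀ ≤ A → ∀ M : ℕ → ℝ, IsBlockSequence A d M →
          IsLC M ∧ NonQuasianalyticSeq M ∧ ModerateGrowth M ∧ BetaThree M ∧
          growthIndexSeq M < 1 ∧ AssocFinite M ∧
          IsBMTWeight (assocFun M) ∧ IsNormalizedWeight (assocFun M) ∧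
          IsNonQuasianalyticWeight (assocFun M) ∧
          ¬ ∃ τ : ℝ → ℝ, IsWeightFunction τ ∧ WeightEquiv τ (assocFun M) ∧
            AlmostSubadditive τ) ∧
        (∀ A A' : ℝ, A₀ ≤ A → A₀ ≤ A' → A ≠ A' → ∀ M M' : ℕ → ℝ,
          IsBlockSequence A d M → IsBlockSequence A' d M' →
            ¬ SeqEquiv M M' ∧ ¬ WeightEquiv (assocFun M) (assocFun M'))) := by
  constructor
  · obtain ⟨d, hd⟩ := exists_isAdmissible (show (2 : ℝ) < 3 by norm_num)
    refine ⟨{M | ∃ A : ℝ, 3 ≤ A ∧ IsBlockSequence A d M}, ?_, ?_, ?_⟩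
    · intro hF
      -- A sequence is equivalent to itself, so inequivalence for distinct parameters already gives
      -- injectivity.
      have hinj : InjOn (fun A => prodSeq (blockQuotient A d)) (Ici 3) := by
        intro A hA A' hA' h
        by_contra hne
        have hM := isBlockSequence_iff.2 (rfl : prodSeq (blockQuotient A d) = _)
        refine (block_not_equiv (by norm_num) hd hA hA' hne hM (isBlockSequence_iff.2 h)).1 (SeqEquiv.refl ?_)
        exact (block_properties (by linarith [mem_Ici.1 hA]) (hd.mono (by norm_num) hA) hM).1.pos
      have hmaps : MapsTo (fun A => prodSeq (blockQuotient A d)) (Ici 3)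
          {M | ∃ A : ℝ, 3 ≤ A ∧ IsBlockSequence A d M} :=
        fun A hA => ⟨A, hA, isBlockSequence_iff.2 rfl⟩
      have hc := hmaps.countable_of_injOn hinj hF
      have h1 := hc.le_aleph0
      rw [Cardinal.mk_Ici_real] at h1
      exact absurd h1 (not_le.2 Cardinal.aleph0_lt_continuum)
    · rintro M ⟨A, hA, hM⟩
      obtain ⟨h1, -, -, -, -, h2, h3, h4, h5, h6⟩ :=
        block_properties (by linarith) (hd.mono (by norm_num) hA) hM
      exact ⟨h1, h2, h3, h4, h5, h6⟩
    · rintro M ⟨A, hA, hM⟩ N ⟨A', hA', hN⟩ hne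
      refine block_not_equiv (by norm_num) hd hA hA' ?_ hM hN
      rintro rfl
      exact hne ((isBlockSequence_iff.1 hM).trans (isBlockSequence_iff.1 hN).symm)
  · intro A₀ hA₀
    refine ⟨exists_isAdmissible hA₀, fun d hd => ⟨fun A _ => ?_, fun A hA M hM => ?_, ?_⟩⟩
    · exact ⟨_, isBlockSequence_iff.2 rfl, fun M hM => isBlockSequence_iff.1 hM⟩
    · exact block_properties (hA₀.trans_le hA) (hd.mono (by linarith) hA) hM
    · intro A A' hA hA' hne M M' hM hM'
      exact block_not_equiv hA₀ hd hA hA' hne hM hM'
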